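/- Let $\Sigma$ be a finite alphabet of constant size. For a finite set $P$ of strings over $\Sigma$ let $\|P\|$ be the sum of their lengths. An overlap from $s$ to $t$ is a string that is both a proper suffix of $s$ and a proper prefix of $t$, and $Ov(P)$ is the set of the longest overlaps from $s$ to $t$, for all $s,t\in P$ (including $s=t$). The hierarchical overlap graph $\mathrm{HOG}(P)$ is the directed graph with vertex set $V=P\cup Ov(P)\cup\{\epsilon\}$ (where $\epsilon$ is the empty string) and with two types of edges: a tree edge $(x,y)$ if $x$ is the longest element of $V$ that is a proper prefix of $y\in V$, and a failure link $(x,y)$ if $y$ is the longest element of $V$ that is a proper suffix of $x\in V$. Theorem. Given a finite set $P$ of strings over $\Sigma$, $\mathrm{HOG}(P)$ can be built in $O(\|P\|)$ time and space. Precisely: for every alphabet size there are one program for the unit-cost word RAM (with registers and arrays, comparison, addition and subtraction) and one constant $C$ such that, for every finite set $P$ of strings, listed in any order, given by their number, their lengths and their concatenation, the program halts after at most $C(\|P\|+1)$ steps, uses at most $C(\|P\|+1)$ memory words (input and output included), all of which hold values at most $C(\|P\|+1)$ throughout, and leaves $\mathrm{HOG}(P)$ in memory: the vertices are numbered $0,\dots,m-1$,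 each vertex is given by the starting position and the length of an occurrence of its string in the concatenated input (distinct numbers standing for distinct strings), and each vertex other than the root $\epsilon$, which has number $0$, stores the source of its incoming tree edge and the target of its outgoing failure link. -/

import Mathlib

namespace HOG

section Graph

variable {α : Type*}

/-- `x` is a proper prefix of `y`. -/
def IsProperPrefix (x y : List α) : Prop := x <+: y ∧ x ≠ y

/-- `x` is a proper suffix of `y`. -/
def IsProperSuffix (x y : List α) : Prop := x <:+ y ∧ x ≠ y

/-- `x` is an overlap from `s` to `t`. -/
def IsOverlap (s t x : List α) : Prop := IsProperSuffix x s ∧ IsProperPrefix x t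

/-- `x` has property `Q` and no string with property `Q` is longer than `x`. -/
def IsLongest (Q : List α → Prop) (x : List α) : Prop :=
  Q x ∧ ∀ y, Q y → y.length ≤ x.length

/-- The set of the longest overlaps from `s` to `t`, for all `s` and `t` in `P`
(`s = t` allowed). -/
def Ov (P : Set (List α)) : Set (List α) :=
  {x | ∃ s ∈ P, ∃ t ∈ P, IsLongest (IsOverlap s t) x}

/-- The vertex set of the hierarchical overlap graph. -/
def vertices (P : Set (List α)) : Set (List α) := P ∪ Ov P ∪ {[]}

/-- A directed graph with two types of edges, on vertices taken from a type `V`. -/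
structure TwoTypeDigraph (V : Type*) where
  verts : Set V
  treeEdges : Set (V × V)
  failureLinks : Set (V × V)

/-- The hierarchical overlap graph of `P`. There is a tree edge `(x, y)` if `x` is the longest
vertex that is a proper prefix of the vertex `y`, and a failure link `(x, y)` if `y` is the longest
vertex that is a proper suffix of the vertex `x`. -/
def hog (P : Set (List α)) : TwoTypeDigraph (List α) where
  verts := vertices P
  treeEdges := {e | e.1 ∈ vertices P ∧ e.2 ∈ vertices P ∧
    IsLongest (fun z => z ∈ vertices P ∧ IsProperPrefix z e.2) e.1}
  failureLinks := {e | e.1 ∈ vertices P ∧ e.2 ∈ vertices P ∧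
    IsLongest (fun z => z ∈ vertices P ∧ IsProperSuffix z e.1) e.2}

/-- `f` is an isomorphism from `G` to `H`: all edges of `G` join vertices of `G`, and `f` is a
bijection between the vertices that preserves and reflects both types of edges. -/
structure TwoTypeDigraph.IsIso {V V' : Type*} (f : V → V')
    (G : TwoTypeDigraph V) (H : TwoTypeDigraph V') : Prop where
  tree_subset : G.treeEdges ⊆ G.verts ×ˢ G.verts
  failure_subset : G.failureLinks ⊆ G.verts ×ˢ G.verts
  bijOn : Set.BijOn f G.verts H.verts
  tree_iff : ∀ u ∈ G.verts, ∀ v ∈ G.verts,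
    ((u, v) ∈ G.treeEdges ↔ (f u, f v) ∈ H.treeEdges)
  failure_iff : ∀ u ∈ G.verts, ∀ v ∈ G.verts,
    ((u, v) ∈ G.failureLinks ↔ (f u, f v) ∈ H.failureLinks)

/-- The sum of the lengths of the strings in a list. -/
def totalLength (L : List (List α)) : ℕ := (L.map List.length).sum

end Graph

/-! ### The machine: a word RAM with registers and arrays, running structured programs -/

/-- The memory: registers `reg r`, and arrays `arr a` with cells `arr a i`. -/
structure State where
  reg : ℕ → ℕ
  arr : ℕ → ℕ → ℕ

/-- Write the value `v` into register `r`. -/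
def State.setReg (s : State) (r v : ℕ) : State :=
  { s with reg := Function.update s.reg r v }

/-- Write the value `v` into cell `i` of array `a`. -/
def State.setArr (s : State) (a i v : ℕ) : State :=
  { s with arr := Function.update s.arr a (Function.update (s.arr a) i v) }

/-- The memory fits into words with values below `W` and arrays with `W` cells. -/
def State.Fits (s : State) (W : ℕ) : Prop :=
  (∀ r, s.reg r < W) ∧ (∀ a i, s.arr a i < W) ∧ ∀ a i, W ≤ i → s.arr a i = 0

/-- Comparisons of two registers. -/
inductive Test where
  | lt (x y : ℕ)
  | le (x y : ℕ)
  | eq (x y : ℕ)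
  | ne (x y : ℕ)

def Test.Holds (s : State) : Test → Prop
  | .lt x y => s.reg x < s.reg y
  | .le x y => s.reg x ≤ s.reg y
  | .eq x y => s.reg x = s.reg y
  | .ne x y => s.reg x ≠ s.reg y

/-- The registers that occur in a test. -/
def Test.regs : Test → Finset ℕ
  | .lt x y => {x, y}
  | .le x y => {x, y}
  | .eq x y => {x, y}
  | .ne x y => {x, y}

/-- Programs. The parameters `r x y` are names of registers, `a` is the name of an array, and `k` is
a numeral: all of them are fixed in the program text. -/
inductive Prog where
  /-- do nothing -/
  | skip
  /-- `r := k` -/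
  | const (r k : ℕ)
  /-- `r := x` -/
  | copy (r x : ℕ)
  /-- `r := x + y` -/
  | add (r x y : ℕ)
  /-- `r := x - y`, truncated at `0` -/
  | sub (r x y : ℕ)
  /-- `r := a[x]` -/
  | load (r a x : ℕ)
  /-- `a[x] := y` -/
  | store (a x y : ℕ)
  | seq (p q : Prog)
  | ite (b : Test) (p q : Prog)
  | while (b : Test) (p : Prog)

/-- `Exec W p s t s'`: on a machine with words for the values below `W` and arrays of `W` cells, the
program `p`, started in memory `s`, halts after `t` steps in memory `s'`, without ever producing a
value or accessing a cell that is out of range. (The remaining instructions copy or decrease values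
already present, so that `State.Fits` is kept.) Every elementary instruction and every evaluation of
a test takes one step. -/
inductive Exec (W : ℕ) : Prog → State → ℕ → State → Prop where
  | skip (s : State) : Exec W .skip s 1 s
  | const (s : State) (r k : ℕ) (h : k < W) : Exec W (.const r k) s 1 (s.setReg r k)
  | copy (s : State) (r x : ℕ) : Exec W (.copy r x) s 1 (s.setReg r (s.reg x))
  | add (s : State) (r x y : ℕ) (h : s.reg x + s.reg y < W) :
      Exec W (.add r x y) s 1 (s.setReg r (s.reg x + s.reg y))
  | sub (s : State) (r x y : ℕ) : Exec W (.sub r x y) s 1 (s.setReg r (s.reg x - s.reg y))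
  | load (s : State) (r a x : ℕ) (h : s.reg x < W) :
      Exec W (.load r a x) s 1 (s.setReg r (s.arr a (s.reg x)))
  | store (s : State) (a x y : ℕ) (h : s.reg x < W) :
      Exec W (.store a x y) s 1 (s.setArr a (s.reg x) (s.reg y))
  | seq {p q : Prog} {s s₁ s₂ : State} {t₁ t₂ : ℕ} (hp : Exec W p s t₁ s₁)
      (hq : Exec W q s₁ t₂ s₂) : Exec W (.seq p q) s (t₁ + t₂) s₂
  | iteTrue {b : Test} {p q : Prog} {s s₁ : State} {t : ℕ} (hb : b.Holds s)
      (hp : Exec W p s t s₁) : Exec W (.ite b p q) s (1 + t) s₁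
  | iteFalse {b : Test} {p q : Prog} {s s₁ : State} {t : ℕ} (hb : ¬ b.Holds s)
      (hq : Exec W q s t s₁) : Exec W (.ite b p q) s (1 + t) s₁
  | whileFalse {b : Test} {p : Prog} {s : State} (hb : ¬ b.Holds s) :
      Exec W (.while b p) s 1 s
  | whileTrue {b : Test} {p : Prog} {s s₁ s₂ : State} {t₁ t₂ : ℕ} (hb : b.Holds s)
      (hp : Exec W p s t₁ s₁) (hw : Exec W (.while b p) s₁ t₂ s₂) :
      Exec W (.while b p) s (1 + t₁ + t₂) s₂

/-- The registers that occur in a program. -/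
def Prog.regs : Prog → Finset ℕ
  | .skip => ∅
  | .const r _ => {r}
  | .copy r x => {r, x}
  | .add r x y => {r, x, y}
  | .sub r x y => {r, x, y}
  | .load r _ x => {r, x}
  | .store _ x y => {x, y}
  | .seq p q => p.regs ∪ q.regs
  | .ite b p q => b.regs ∪ p.regs ∪ q.regs
  | .while b p => b.regs ∪ p.regs

/-- The arrays that occur in a program. -/
def Prog.arrays : Prog → Finset ℕ
  | .load _ a _ => {a}
  | .store a _ _ => {a}
  | .seq p q => p.arrays ∪ q.arrays
  | .ite _ p q => p.arrays ∪ q.arrays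
  | .while _ p => p.arrays
  | _ => ∅

/-- The number of memory words (input and output included) that a program has at its disposal on a
machine whose arrays have `W` cells. -/
def Prog.space (p : Prog) (W : ℕ) : ℕ := p.regs.card + p.arrays.card * W

/-! ### Input and output -/

/-- The input: register `0` holds the number of strings, array `0` their lengths and array `1` their
concatenation, the letters being coded by `0, …, σ - 1`. The rest of the memory is `0`. -/
def inputState {σ : ℕ} (L : List (List (Fin σ))) : State where
  reg r := if r = 0 then L.length else 0
  arr a i :=
    if a = 0 then (L.map List.length).getD i 0
    else if a = 1 then (L.flatten.map Fin.val).getD i 0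
    else 0

/-- The graph that is stored in a memory: its vertices are `0, …, m - 1`, with `m` in register `0`;
every vertex `v ≠ 0` has one incoming tree edge, from the vertex in cell `v` of array `4`, and one
outgoing failure link, to the vertex in cell `v` of array `5`. -/
def outputGraph (s : State) : TwoTypeDigraph ℕ where
  verts := {v | v < s.reg 0}
  treeEdges := {e | e.2 ≠ 0 ∧ e.2 < s.reg 0 ∧ e.1 = s.arr 4 e.2}
  failureLinks := {e | e.1 ≠ 0 ∧ e.1 < s.reg 0 ∧ e.2 = s.arr 5 e.1}

/-- The string of vertex `v` of the stored graph: the piece of the concatenated input that starts at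
the position in cell `v` of array `2` and whose length is in cell `v` of array `3`. -/
def outputString {σ : ℕ} (L : List (List (Fin σ))) (s : State) (v : ℕ) : List (Fin σ) :=
  (L.flatten.drop (s.arr 2 v)).take (s.arr 3 v)

/-- The memory `s` stores the hierarchical overlap graph of the strings in `L`, its vertices being
given by their positions in the concatenated input, which is still there. -/
structure StoresHog {σ : ℕ} (L : List (List (Fin σ))) (s : State) : Prop where
  text : s.arr 1 = (inputState L).arr 1
  length_eq : ∀ v < s.reg 0, (outputString L s v).length = s.arr 3 v
  iso : (outputGraph s).IsIso (outputString L s) (hog {x | x ∈ L})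

end HOG

/-! Every vertex of the graph is a node of the trie of `L` (`IsNode`), so the task is to decide
which nodes are vertices. By `mem_vertices_iff`, a nonempty node outside `L` is a vertex iff, for
some `s ∈ L`, it is a proper suffix of `s` and some `t ∈ L` extends it without extending any longer
node that is a proper suffix of `s` (`Covers`). These proper suffixes form the failure chain `fail L
s`, `fail L (fail L s)`, …, whose lengths strictly decrease, so walking all chains takes at most
`‖P‖` steps.

The test at a chain node `u` must take constant time. Let `size L u` count the strings extending
`u`. If `t` extends `u` and a longer chain node `v`, then iterating `bord` from `v` stays on the
chain and among the prefixes of `t` until it reaches `u`; hence `t` extends a chain node `y` with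
`bord y = u` (`IsChain.exists_bord_eq`). There is only one such `y`, because of two candidates the
shorter would be a border of the longer (`disjoint_of_bord_eq`). So the strings lost to longer chain
nodes number `∑ size L y` over the chain nodes `y` with `bord y = u`, and `u` passes iff this sum is
less than `size L u` (`IsChain.sum_lt_iff`). The walk maintains the sums: at `u` it adds `size L u`
to the cell of `bord u`, which lies further down the same chain, and clears the cell of `u`.

The maps `fail` and `bord` come from a breadth-first search that stores full transition rows,
affordable for a constant alphabet. The value `fail L (u ++ [a])` is an entry in the row of `fail L
u` (`fail_append`). The row `btrans u` is the row of `bord u`, changed only at the letter following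
`bord u` in `u` (`btrans_of_prefix`, `btrans_of_not_prefix`). Both source rows belong to shorter
nodes and are complete, so no fallback loop is needed.

In the output, again in breadth-first order, a node inherits its longest vertex prefix from its
parent and its longest vertex suffix from its failure node. Running times follow from weakest
preconditions for loop-free code (`Runs.of_wp`) and potentials for loops (`Runs.loop`). -/

namespace HOG

set_option linter.unusedSimpArgs false

/-! ### Program logic with a time bound -/

/-- The program `p`, started in memory `s`, halts after at most `T` steps in a memory that
satisfies `Q`. -/
def Runs (W : ℕ) (p : Prog) (s : State) (T : ℕ) (Q : State → Prop) : Prop :=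
  ∃ t s', Exec W p s t s' ∧ t ≤ T ∧ Q s'

namespace State

theorem reg_setReg (s : State) (r v r' : ℕ) :
    (s.setReg r v).reg r' = if r' = r then v else s.reg r' := by
  simp [setReg, Function.update_apply]

theorem arr_setReg (s : State) (r v : ℕ) : (s.setReg r v).arr = s.arr := rfl

theorem reg_setArr (s : State) (a i v : ℕ) : (s.setArr a i v).reg = s.reg := rfl

theorem arr_setArr (s : State) (a i v b : ℕ) :
    (s.setArr a i v).arr b = if b = a then Function.update (s.arr a) i v else s.arr b := by
  simp [setArr, Function.update_apply]

end State

/-- Sequential composition of a list of programs. -/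
def block : List Prog → Prog
  | [] => .skip
  | p :: ps => .seq p (block ps)

/-- The weakest precondition of a loop-free program. -/
def wp (W : ℕ) : Prog → (State → Prop) → State → Prop
  | .skip, Q, s => Q s
  | .const r k, Q, s => k < W ∧ Q (s.setReg r k)
  | .copy r x, Q, s => Q (s.setReg r (s.reg x))
  | .add r x y, Q, s => s.reg x + s.reg y < W ∧ Q (s.setReg r (s.reg x + s.reg y))
  | .sub r x y, Q, s => Q (s.setReg r (s.reg x - s.reg y))
  | .load r a x, Q, s => s.reg x < W ∧ Q (s.setReg r (s.arr a (s.reg x)))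
  | .store a x y, Q, s => s.reg x < W ∧ Q (s.setArr a (s.reg x) (s.reg y))
  | .seq p q, Q, s => wp W p (wp W q Q) s
  | .ite b p q, Q, s => (b.Holds s → wp W p Q s) ∧ (¬ b.Holds s → wp W q Q s)
  | .while _ _, _, _ => False

/-- A bound on the number of steps of a loop-free program. -/
def cost : Prog → ℕ
  | .seq p q => cost p + cost q
  | .ite _ p q => 1 + (cost p + cost q)
  | _ => 1

/-- Whether a program writes into register `r`. -/
def writesReg : Prog → ℕ → Bool
  | .const r _, r' => r' == r
  | .copy r _, r' => r' == r
  | .add r _ _, r' => r' == r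
  | .sub r _ _, r' => r' == r
  | .load r _ _, r' => r' == r
  | .seq p q, r' => writesReg p r' || writesReg q r'
  | .ite _ p q, r' => writesReg p r' || writesReg q r'
  | .while _ p, r' => writesReg p r'
  | _, _ => false

/-- Whether a program writes into array `a`. -/
def writesArr : Prog → ℕ → Bool
  | .store a _ _, a' => a' == a
  | .seq p q, a' => writesArr p a' || writesArr q a'
  | .ite _ p q, a' => writesArr p a' || writesArr q a'
  | .while _ p, a' => writesArr p a'
  | _, _ => false

/-- The memories `s` and `s'` agree on the registers and arrays that `p` does not write into. -/
def Agrees (p : Prog) (s s' : State) : Prop :=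
  (∀ r, writesReg p r = false → s'.reg r = s.reg r) ∧
    ∀ a, writesArr p a = false → s'.arr a = s.arr a

theorem Agrees.refl (p : Prog) (s : State) : Agrees p s s := ⟨fun _ _ => rfl, fun _ _ => rfl⟩

theorem Agrees.trans {p : Prog} {s s' s'' : State} (h : Agrees p s s') (h' : Agrees p s' s'') :
    Agrees p s s'' :=
  ⟨fun r hr => (h'.1 r hr).trans (h.1 r hr), fun a ha => (h'.2 a ha).trans (h.2 a ha)⟩

theorem Agrees.mono {p q : Prog} {s s' : State} (h : Agrees p s s')
    (hr : ∀ r, writesReg q r = false → writesReg p r = false)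
    (ha : ∀ a, writesArr q a = false → writesArr p a = false) : Agrees q s s' :=
  ⟨fun r h' => h.1 r (hr r h'), fun a h' => h.2 a (ha a h')⟩

/-- The frame property. Since `writesReg` and `writesArr` are computable, preservation of untouched
memory is later settled by `rfl` or `decide`. -/
theorem Exec.agrees {W : ℕ} {p : Prog} {s s' : State} {t : ℕ} (h : Exec W p s t s') :
    Agrees p s s' := by
  induction h with
  | skip | copy | const | add | sub | load | store =>
    constructor <;> intro x hx <;>
      simp_all [writesReg, writesArr, State.reg_setReg, State.arr_setReg, State.reg_setArr,
        State.arr_setArr]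
  | seq _ _ ihp ihq =>
    exact (ihp.mono (by simp +contextual [writesReg]) (by simp +contextual [writesArr])).trans
      (ihq.mono (by simp +contextual [writesReg]) (by simp +contextual [writesArr]))
  | iteTrue _ _ ih | iteFalse _ _ ih =>
    exact ih.mono (by simp +contextual [writesReg]) (by simp +contextual [writesArr])
  | whileFalse => exact .refl _ _
  | whileTrue _ _ _ ihp ihw =>
    exact (ihp.mono (by simp +contextual [writesReg]) (by simp +contextual [writesArr])).trans ihw

/-! ### Rules for runs with a time bound -/

namespace Runs

variable {W : ℕ} {p q : Prog} {s : State} {T T' : ℕ} {Q Q' : State → Prop}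

theorem mono (h : Runs W p s T Q) (hT : T ≤ T') (hQ : ∀ s', Q s' → Q' s') :
    Runs W p s T' Q' := by
  obtain ⟨t, s', he, ht, hq⟩ := h
  exact ⟨t, s', he, ht.trans hT, hQ _ hq⟩

theorem seq (h : Runs W p s T (fun s' => Runs W q s' T' Q)) :
    Runs W (.seq p q) s (T + T') Q := by
  obtain ⟨t, s', he, ht, t', s'', he', ht', hq⟩ := h
  exact ⟨_, s'', .seq he he', add_le_add ht ht', hq⟩

/-- A conditional is charged for both branches, so that `cost` does not depend on the memory. -/
theorem of_wp (p : Prog) {s : State} {Q : State → Prop} (h : wp W p Q s) :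
    Runs W p s (cost p) Q := by
  induction p generalizing s Q with
  | skip => exact ⟨_, _, .skip s, le_rfl, h⟩
  | const r k => exact ⟨_, _, .const s r k h.1, le_rfl, h.2⟩
  | copy r x => exact ⟨_, _, .copy s r x, le_rfl, h⟩
  | add r x y => exact ⟨_, _, .add s r x y h.1, le_rfl, h.2⟩
  | sub r x y => exact ⟨_, _, .sub s r x y, le_rfl, h⟩
  | load r a x => exact ⟨_, _, .load s r a x h.1, le_rfl, h.2⟩
  | store a x y => exact ⟨_, _, .store s a x y h.1, le_rfl, h.2⟩
  | seq p q ihp ihq => exact Runs.seq ((ihp h).mono le_rfl fun _ h' => ihq h')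
  | ite b p q ihp ihq =>
    by_cases hb : b.Holds s
    · obtain ⟨t, s', he, ht, hq⟩ := ihp (h.1 hb)
      exact ⟨_, s', .iteTrue hb he, by simp only [cost]; lia, hq⟩
    · obtain ⟨t, s', he, ht, hq⟩ := ihq (h.2 hb)
      exact ⟨_, s', .iteFalse hb he, by simp only [cost]; lia, hq⟩
  | _ => exact h.elim

theorem frame (h : Runs W p s T Q) : Runs W p s T (fun s' => Q s' ∧ Agrees p s s') := by
  obtain ⟨t, s', he, ht, hq⟩ := h
  exact ⟨t, s', he, ht, hq, he.agrees⟩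

/-- The rule for loops: `I` is an invariant and `φ` a potential that pays for every round. -/
theorem loop {b : Test} {s₀ : State} (I : State → Prop) (φ : State → ℕ)
    (hstep : ∀ s, Agrees p s₀ s → I s → b.Holds s →
      ∃ c, Runs W p s c (fun s' => I s' ∧ φ s' + c + 1 ≤ φ s))
    (h0 : I s₀) :
    Runs W (.while b p) s₀ (φ s₀ + 1) (fun s' => I s' ∧ ¬ b.Holds s' ∧ Agrees p s₀ s') := by
  suffices ∀ s, Agrees p s₀ s → I s →
      Runs W (.while b p) s (φ s + 1) (fun s' => I s' ∧ ¬ b.Holds s' ∧ Agrees p s₀ s') from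
    this s₀ (.refl _ _) h0
  intro s hs hI
  induction hn : φ s using Nat.strong_induction_on generalizing s with
  | _ n ih =>
    by_cases hb : b.Holds s
    · obtain ⟨c, t, s', he, ht, hI', hφ⟩ := hstep s hs hI hb
      obtain ⟨t', s'', he', ht', hq⟩ := ih (φ s') (by lia) s' (hs.trans he.agrees) hI' rfl
      exact ⟨_, s'', .whileTrue hb he he', by lia, hq⟩
    · exact ⟨1, s, .whileFalse hb, by lia, hI, hb, hs⟩

end Runs

section Strings

variable {α : Type*}

/-! ### Longest suffixes with a given property -/

open Classical in
/-- The longest suffix of a string with property `N`. -/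
noncomputable def lsuf (N : List α → Prop) : List α → List α
  | [] => []
  | x :: w => if N (x :: w) then x :: w else lsuf N w

theorem lsuf_suffix (N : List α → Prop) (w : List α) : lsuf N w <:+ w := by
  induction w with
  | nil => exact List.suffix_rfl
  | cons x w ih =>
    unfold lsuf
    split_ifs
    · exact List.suffix_rfl
    · exact ih.trans (List.suffix_cons x w)

theorem lsuf_mem {N : List α → Prop} (hN : N []) (w : List α) : N (lsuf N w) := by
  induction w with
  | nil => exact hN
  | cons x w ih =>
    unfold lsuf
    split_ifs with h
    exacts [h, ih]

theorem suffix_lsuf {N : List α → Prop} {v w : List α} (hv : v <:+ w) (h : N v) :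
    v <:+ lsuf N w := by
  induction w with
  | nil => exact hv
  | cons x w ih =>
    unfold lsuf
    split_ifs with hx
    · exact hv
    · rcases List.suffix_cons_iff.1 hv with rfl | hv
      exacts [(hx h).elim, ih hv]

theorem lsuf_of_mem {N : List α → Prop} {w : List α} (h : N w) : lsuf N w = w := by
  cases w with
  | nil => rfl
  | cons x w => simp [lsuf, h]

theorem lsuf_congr {N N' : List α → Prop} {w : List α} (h : ∀ v, v <:+ w → (N v ↔ N' v)) :
    lsuf N w = lsuf N' w := by
  induction w with
  | nil => rfl
  | cons x w ih =>
    unfold lsuf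
    rw [ih fun v hv => h v (hv.trans (List.suffix_cons x w))]
    have hx := h _ List.suffix_rfl
    by_cases h' : N (x :: w)
    · simp [h', hx.1 h']
    · simp [h', hx.not.1 h']

/-- Deleting the last letter of a nonempty `N`-suffix of `w ++ [a]` leaves an `N`-suffix of `w`,
hence a suffix of `lsuf N w`. This identity is the source of the recursions for both `fail` and
`bord`. -/
theorem lsuf_append {N : List α → Prop} (hN : ∀ v a, N (v ++ [a]) → N v) (w : List α) (a : α) :
    lsuf N (w ++ [a]) = lsuf N (lsuf N w ++ [a]) := by
  induction w with
  | nil => rfl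
  | cons x w ih =>
    by_cases h : N (x :: w)
    · rw [lsuf_of_mem h]
    · have h' : ¬ N (x :: (w ++ [a])) := fun h' => h (hN _ a h')
      simp only [List.cons_append, lsuf, h, h', if_false, ih]

theorem suffix_tail {v w : List α} (h : v <:+ w) (hne : v ≠ w) : v <:+ w.tail := by
  cases w with
  | nil => exact (hne (List.suffix_nil.1 h)).elim
  | cons x w => exact (List.suffix_cons_iff.1 h).resolve_left hne

theorem length_lsuf_tail_lt (N : List α → Prop) {w : List α} (h : w ≠ []) :
    (lsuf N w.tail).length < w.length := by
  have h1 := (lsuf_suffix N w.tail).length_le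
  have h2 := List.length_pos_iff.2 h
  simp only [List.length_tail] at h1
  lia

theorem suffix_of_suffix_of_length_le {u v s : List α} (hu : u <:+ s) (hv : v <:+ s)
    (h : u.length ≤ v.length) : u <:+ v :=
  List.suffix_of_suffix_length_le hu hv h

theorem suffix_length_lt {u v : List α} (h : u <:+ v) (hne : u ≠ v) : u.length < v.length :=
  lt_of_le_of_ne h.length_le fun h' => hne (h.eq_of_length h')

/-! ### The trie of a list of strings -/

/-- `w` is a node of the trie of `L`: the root or a prefix of an element of `L`. -/
def IsNode (L : List (List α)) (w : List α) : Prop := w = [] ∨ ∃ t ∈ L, w <+: t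

theorem isNode_nil (L : List (List α)) : IsNode L [] := .inl rfl

theorem IsNode.of_prefix {L : List (List α)} {v w : List α} (h : IsNode L w) (hv : v <+: w) :
    IsNode L v := by
  rcases h with rfl | ⟨t, ht, hw⟩
  · exact .inl (List.prefix_nil.1 hv)
  · exact .inr ⟨t, ht, hv.trans hw⟩

theorem IsNode.of_append {L : List (List α)} (v : List α) (a : α) (h : IsNode L (v ++ [a])) :
    IsNode L v :=
  h.of_prefix (List.prefix_append _ _)

theorem IsNode.of_mem {L : List (List α)} {w : List α} (h : w ∈ L) : IsNode L w :=
  .inr ⟨w, h, List.prefix_rfl⟩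

/-- The longest proper suffix of `u` that is a node. -/
noncomputable def fail (L : List (List α)) (u : List α) : List α := lsuf (IsNode L) u.tail

/-- The longest suffix of `u ++ [a]` that is a node. -/
noncomputable def trans (L : List (List α)) (u : List α) (a : α) : List α :=
  lsuf (IsNode L) (u ++ [a])

/-- The longest border of `u`. -/
noncomputable def bord (u : List α) : List α := lsuf (· <+: u) u.tail

/-- The longest proper suffix of `u ++ [a]` that is a prefix of `u`. -/
noncomputable def btrans (u : List α) (a : α) : List α := lsuf (· <+: u) (u ++ [a]).tail

theorem isNode_fail (L : List (List α)) (u : List α) : IsNode L (fail L u) :=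
  lsuf_mem (isNode_nil L) _

theorem fail_suffix (L : List (List α)) (u : List α) : fail L u <:+ u :=
  (lsuf_suffix _ _).trans (List.tail_suffix u)

theorem length_fail_lt (L : List (List α)) {u : List α} (h : u ≠ []) :
    (fail L u).length < u.length :=
  length_lsuf_tail_lt _ h

theorem suffix_fail {L : List (List α)} {u v : List α} (hv : IsNode L v) (h : v <:+ u)
    (hne : v ≠ u) : v <:+ fail L u :=
  suffix_lsuf (suffix_tail h hne) hv

theorem trans_of_isNode {L : List (List α)} {u : List α} {a : α} (h : IsNode L (u ++ [a])) :
    trans L u a = u ++ [a] :=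
  lsuf_of_mem h

theorem trans_nil_of_not_isNode {L : List (List α)} {a : α} (h : ¬ IsNode L [a]) :
    trans L [] a = [] := by
  simp [trans, lsuf, h]

/-- The root has to be excluded: `fail L [a]` is empty, while `trans L [] a` is `[a]` if that is a
node. -/
theorem fail_append {L : List (List α)} {u : List α} (hu : u ≠ []) (a : α) :
    fail L (u ++ [a]) = trans L (fail L u) a := by
  rw [fail, List.tail_append_of_ne_nil hu, lsuf_append IsNode.of_append]
  rfl

theorem trans_of_not_isNode {L : List (List α)} {u : List α} (hu : u ≠ []) {a : α}
    (h : ¬ IsNode L (u ++ [a])) : trans L u a = trans L (fail L u) a := by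
  rw [← fail_append hu]
  cases u with
  | nil => exact (hu rfl).elim
  | cons x u =>
    simp only [List.cons_append] at h
    simp [trans, fail, lsuf, h]

theorem fail_singleton (L : List (List α)) (a : α) : fail L [a] = [] := rfl

theorem fail_nil (L : List (List α)) : fail L [] = [] := rfl

theorem bord_nil : bord ([] : List α) = [] := rfl

theorem bord_prefix (u : List α) : bord u <+: u :=
  lsuf_mem (N := (· <+: u)) List.nil_prefix _

theorem bord_suffix (u : List α) : bord u <:+ u :=
  (lsuf_suffix _ _).trans (List.tail_suffix u)

theorem length_bord_lt {u : List α} (h : u ≠ []) : (bord u).length < u.length :=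
  length_lsuf_tail_lt _ h

theorem suffix_bord {u v : List α} (hp : v <+: u) (h : v <:+ u) (hne : v ≠ u) : v <:+ bord u :=
  suffix_lsuf (N := (· <+: u)) (suffix_tail h hne) hp

/-- A proper suffix of `u ++ [a]` is no longer than `u`, so being a prefix of `u ++ [a]` or of `u`
is the same for it. -/
theorem bord_append (u : List α) (a : α) : bord (u ++ [a]) = btrans u a := by
  refine lsuf_congr fun v hv => ?_
  have := hv.length_le
  simp only [List.length_tail, List.length_append, List.length_singleton] at this
  exact ⟨fun h => List.prefix_of_prefix_length_le h (List.prefix_append _ _) (by lia),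
    fun h => h.trans (List.prefix_append _ _)⟩

theorem btrans_nil (a : α) : btrans [] a = [] := rfl

theorem btrans_of_prefix {u : List α} (hu : u ≠ []) {a : α} (h : bord u ++ [a] <+: u) :
    btrans u a = bord u ++ [a] := by
  have hN : ∀ v b, v ++ [b] <+: u → v <+: u := fun v b h => (List.prefix_append _ _).trans h
  rw [btrans, List.tail_append_of_ne_nil hu, lsuf_append hN]
  exact lsuf_of_mem (N := (· <+: u)) h

/-- The remaining candidates are no longer than `bord u`, and among such strings the prefixes of `u`
are the prefixes of `bord u`. -/
theorem btrans_of_not_prefix {u : List α} (hu : u ≠ []) {a : α} (h : ¬ bord u ++ [a] <+: u) :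
    btrans u a = btrans (bord u) a := by
  have hN : ∀ v b, v ++ [b] <+: u → v <+: u := fun v b h => (List.prefix_append _ _).trans h
  rw [btrans, List.tail_append_of_ne_nil hu, lsuf_append hN]
  change lsuf (· <+: u) (bord u ++ [a]) = lsuf (· <+: bord u) (bord u ++ [a]).tail
  have hp := bord_prefix u
  revert h hp
  generalize bord u = b
  intro h hp
  cases b with
  | nil => simp only [List.nil_append] at h; simp [lsuf, h]
  | cons x b =>
    simp only [List.cons_append] at h
    simp only [List.cons_append, lsuf, h, if_false, List.tail_cons]
    refine lsuf_congr fun v hv => ?_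
    have := hv.length_le
    simp only [List.length_append, List.length_singleton] at this
    exact ⟨fun h => List.prefix_of_prefix_length_le h hp (by simpa using this),
      fun h => h.trans hp⟩

theorem prefix_append_singleton_iff {u b : List α} (h : b <+: u) (hlt : b.length < u.length)
    (a : α) : b ++ [a] <+: u ↔ u[b.length] = a := by
  obtain ⟨r, rfl⟩ := h
  cases r with
  | nil => simp at hlt
  | cons x r => simp [eq_comm]

/-! ### The vertices of the hierarchical overlap graph -/

/-- The string `u` is a prefix of some `t ∈ L` that has no longer prefix among the nodes that are
proper suffixes of `s`. -/
def Covers (L : List (List α)) (s u : List α) : Prop :=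
  ∃ t ∈ L, u <+: t ∧ ∀ v, IsNode L v → v <:+ s → v ≠ s → u.length < v.length → ¬ v <+: t

/-- `Covers` ignores that an overlap must be a proper prefix of `t`, which makes it a pure counting
condition. The two notions differ only when `t` is itself a suffix of `s`, and those cases are
harmless: they can be moved to the pair `(t, t)` or concern an element of `L`. -/
theorem mem_vertices_iff {L : List (List α)} {w : List α} :
    w ∈ vertices {x | x ∈ L} ↔
      w = [] ∨ w ∈ L ∨ ∃ s ∈ L, w <:+ s ∧ w ≠ s ∧ Covers L s w := by
  constructor
  · rintro ((h | ⟨s, hs, t, ht, ⟨⟨hws, hwt⟩, hmax⟩⟩) | h)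
    · exact .inr (.inl h)
    · refine .inr (.inr ?_)
      -- If `t` is a proper suffix of `s`, it would block `w` as a chain node. But then `w` is the
      -- longest border of `t`, and `t` can replace `s`.
      by_cases h : t <:+ s ∧ t ≠ s
      · refine ⟨t, ht, suffix_of_suffix_of_length_le hws.1 h.1 hwt.1.length_le, hwt.2, t, ht,
          hwt.1, fun v _ hv hne hlt hvt => ?_⟩
        refine hlt.not_ge (hmax v ⟨⟨hv.trans h.1, ?_⟩, hvt, hne⟩)
        rintro rfl
        exact hne (hv.eq_of_length (le_antisymm hv.length_le h.1.length_le))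
      · refine ⟨s, hs, hws.1, hws.2, t, ht, hwt.1, fun v _ hv hne hlt hvt => ?_⟩
        refine hlt.not_ge (hmax v ⟨⟨hv, hne⟩, hvt, ?_⟩)
        rintro rfl
        exact h ⟨hv, hne⟩
    · exact .inl h
  · rintro (h | h | ⟨s, hs, hws, hne, t, ht, hwt, hmax⟩)
    · exact .inr h
    · exact .inl (.inl h)
    · by_cases hw : w ∈ L
      · exact .inl (.inl hw)
      · refine .inl (.inr ⟨s, hs, t, ht, ⟨⟨hws, hne⟩, hwt, fun h => hw (h ▸ ht)⟩, ?_⟩)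
        rintro y ⟨hys, hyt⟩
        by_contra! hlt
        exact hmax y (.inr ⟨t, ht, hyt.1⟩) hys.1 hys.2 hlt hyt.1

theorem isNode_of_mem_vertices {L : List (List α)} {w : List α}
    (h : w ∈ vertices {x | x ∈ L}) : IsNode L w := by
  rcases mem_vertices_iff.1 h with h | h | ⟨s, -, -, -, t, ht, hwt, -⟩
  exacts [.inl h, .of_mem h, .inr ⟨t, ht, hwt⟩]

/-- The set of the nodes on the failure chain of `s` that are longer than `u`. -/
def IsChain (L : List (List α)) (s u : List α) (X : Finset (List α)) : Prop :=
  ∀ v, v ∈ X ↔ IsNode L v ∧ v <:+ s ∧ v ≠ s ∧ u.length < v.length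

theorem IsChain.nil {L : List (List α)} {s : List α} :
    IsChain L s (fail L s) ∅ := by
  intro v
  simp only [Finset.notMem_empty, false_iff]
  rintro ⟨h1, h2, h3, h4⟩
  exact h4.not_ge (suffix_fail h1 h2 h3).length_le

theorem IsChain.notMem {L : List (List α)} {s u : List α} {X : Finset (List α)}
    (hX : IsChain L s u X) : u ∉ X :=
  fun h => lt_irrefl _ ((hX u).1 h).2.2.2

/-! ### Counting the strings below the nodes of a failure chain -/

variable [DecidableEq α]

/-- The number of strings in `L` with prefix `w`. -/
def size (L : List (List α)) (w : List α) : ℕ := L.countP (fun t => decide (w <+: t))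

theorem size_eq_card {L : List (List α)} (hL : L.Nodup) (w : List α) :
    size L w = (L.toFinset.filter (w <+: ·)).card := by
  rw [size, List.countP_eq_length_filter, ← List.toFinset_card_of_nodup (hL.filter _),
    List.toFinset_filter]
  simp

theorem size_le_length (L : List (List α)) (w : List α) : size L w ≤ L.length :=
  List.countP_le_length

/-- Nodes on the failure chain of `s` that have the same longest border do not have common
extensions. -/
theorem disjoint_of_bord_eq {s v w u t : List α} (hv : v <:+ s) (hw : w <:+ s) (hv0 : v ≠ [])
    (hw0 : w ≠ []) (hvu : bord v = u) (hwu : bord w = u) (hvt : v <+: t) (hwt : w <+: t) :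
    v = w := by
  wlog h : v.length ≤ w.length generalizing v w
  · exact (this hw hv hw0 hv0 hwu hvu hwt hvt (by lia)).symm
  by_contra hne
  -- The shorter node `v` is a border of `w`, hence no longer than `bord w = bord v`, which is
  -- shorter than `v`.
  have h1 := (suffix_bord (List.prefix_of_prefix_length_le hvt hwt h)
    (suffix_of_suffix_of_length_le hv hw h) hne).length_le
  have h2 := length_bord_lt hv0
  rw [hwu] at h1
  rw [hvu] at h2
  lia

theorem sum_size_eq_card {L : List (List α)} (hL : L.Nodup) {s u : List α} {Y : Finset (List α)}
    (hY : ∀ v ∈ Y, v <:+ s ∧ v ≠ [] ∧ bord v = u) :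
    ∑ v ∈ Y, size L v = (Y.biUnion fun v => L.toFinset.filter (v <+: ·)).card := by
  rw [Finset.card_biUnion]
  · exact Finset.sum_congr rfl fun v _ => size_eq_card hL v
  · intro v hv w hw hne
    refine Finset.disjoint_left.2 fun t htv htw => hne ?_
    obtain ⟨h1, h2, h3⟩ := hY v hv
    obtain ⟨h4, h5, h6⟩ := hY w hw
    exact disjoint_of_bord_eq h1 h4 h2 h5 h3 h6 (Finset.mem_filter.1 htv).2
      (Finset.mem_filter.1 htw).2

theorem biUnion_subset_of_bord_eq {L : List (List α)} {u : List α} {Y : Finset (List α)}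
    (hY : ∀ v ∈ Y, bord v = u) :
    (Y.biUnion fun v => L.toFinset.filter (v <+: ·)) ⊆ L.toFinset.filter (u <+: ·) := by
  intro t ht
  obtain ⟨v, hv, ht⟩ := Finset.mem_biUnion.1 ht
  obtain ⟨h1, h2⟩ := Finset.mem_filter.1 ht
  exact Finset.mem_filter.2 ⟨h1, (hY v hv ▸ bord_prefix v).trans h2⟩

theorem sum_size_le {L : List (List α)} (hL : L.Nodup) {s u : List α} {Y : Finset (List α)}
    (hY : ∀ v ∈ Y, v <:+ s ∧ v ≠ [] ∧ bord v = u) : ∑ v ∈ Y, size L v ≤ size L u := by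
  rw [sum_size_eq_card hL hY, size_eq_card hL]
  exact Finset.card_le_card (biUnion_subset_of_bord_eq fun v hv => (hY v hv).2.2)

/-- This keeps the accumulators of the marking phase within the word size. -/
theorem IsChain.sum_le {L : List (List α)} (hL : L.Nodup) {s u : List α} {X : Finset (List α)}
    (hX : IsChain L s u X) (w : List α) : ∑ v ∈ X with bord v = w, size L v ≤ size L w := by
  refine sum_size_le hL (s := s) fun v hv => ?_
  obtain ⟨hv, hb⟩ := Finset.mem_filter.1 hv
  obtain ⟨-, h1, -, h2⟩ := (hX v).1 hv
  exact ⟨h1, List.length_pos_iff.1 (by lia), hb⟩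

/-- Descent along `bord` from `v`: each border is again a chain node and a prefix of `t`, and it
cannot skip `u`, which is a border of every longer chain node that is a prefix of `t`. -/
theorem IsChain.exists_bord_eq {L : List (List α)} {s u t : List α} {X : Finset (List α)}
    (hX : IsChain L s u X) (hu : u <:+ s) (hut : u <+: t) {v : List α} (hv : v ∈ X)
    (hvt : v <+: t) : ∃ y ∈ X, bord y = u ∧ y <+: t := by
  induction hn : v.length using Nat.strong_induction_on generalizing v with
  | _ n ih =>
    obtain ⟨h1, h2, h3, h4⟩ := (hX v).1 hv
    have hv0 : v ≠ [] := List.length_pos_iff.1 (by lia)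
    have hub : u <:+ bord v := suffix_bord (List.prefix_of_prefix_length_le hut hvt h4.le)
      (suffix_of_suffix_of_length_le hu h2 h4.le) (fun h => by simp [h] at h4)
    by_cases hb : bord v = u
    · exact ⟨v, hv, hb, hvt⟩
    · have hlt := length_bord_lt hv0
      have hvs := h2.length_le
      refine ih _ (hn ▸ hlt) ((hX _).2 ⟨h1.of_prefix (bord_prefix v), (bord_suffix v).trans h2,
        fun h => ?_, suffix_length_lt hub (Ne.symm hb)⟩) ((bord_prefix v).trans hvt) rfl
      rw [h] at hlt
      lia

/-- The sum counts exactly the strings extending `u` that also extend a longer chain node; the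
inequality is strict iff some string is left over. -/
theorem IsChain.sum_lt_iff {L : List (List α)} (hL : L.Nodup) {s u : List α}
    {X : Finset (List α)} (hX : IsChain L s u X) (hu : u <:+ s) :
    ∑ v ∈ X with bord v = u, size L v < size L u ↔ Covers L s u := by
  have hY : ∀ v ∈ X.filter (bord · = u), v <:+ s ∧ v ≠ [] ∧ bord v = u := by
    intro v hv
    obtain ⟨hv, hb⟩ := Finset.mem_filter.1 hv
    obtain ⟨-, h1, -, h2⟩ := (hX v).1 hv
    exact ⟨h1, List.length_pos_iff.1 (by lia), hb⟩
  have hsub := biUnion_subset_of_bord_eq (L := L) fun v hv => (hY v hv).2.2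
  rw [sum_size_eq_card hL hY, size_eq_card hL]
  constructor
  · intro h
    obtain ⟨t, ht, hnt⟩ := Finset.exists_mem_notMem_of_card_lt_card h
    obtain ⟨htL, hut⟩ := Finset.mem_filter.1 ht
    refine ⟨t, List.mem_toFinset.1 htL, hut, fun v h1 h2 h3 h4 hvt => hnt ?_⟩
    obtain ⟨y, hy, hb, hyt⟩ := hX.exists_bord_eq hu hut ((hX v).2 ⟨h1, h2, h3, h4⟩) hvt
    exact Finset.mem_biUnion.2 ⟨y, Finset.mem_filter.2 ⟨hy, hb⟩, Finset.mem_filter.2 ⟨htL, hyt⟩⟩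
  · rintro ⟨t, ht, hut, hmax⟩
    refine Finset.card_lt_card ((Finset.ssubset_iff_of_subset hsub).2
      ⟨t, Finset.mem_filter.2 ⟨List.mem_toFinset.2 ht, hut⟩, fun h => ?_⟩)
    obtain ⟨v, hv, hvt⟩ := Finset.mem_biUnion.1 h
    obtain ⟨h1, h2, h3, h4⟩ := (hX v).1 (Finset.mem_filter.1 hv).1
    exact hmax v h1 h2 h3 h4 (Finset.mem_filter.1 hvt).2

/-- Suffixes of `s` no longer than `u` are suffixes of `u`, so `u` is the only chain node longer
than `fail L u` that is not already in `X`. -/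
theorem IsChain.insert {L : List (List α)} {s u : List α} {X : Finset (List α)}
    (hX : IsChain L s u X) (hu : IsNode L u) (hus : u <:+ s) (hne : u ≠ s) (hu0 : u ≠ []) :
    IsChain L s (fail L u) (insert u X) := by
  intro v
  rw [Finset.mem_insert, hX v]
  constructor
  · rintro (rfl | ⟨h1, h2, h3, h4⟩)
    · exact ⟨hu, hus, hne, length_fail_lt L hu0⟩
    · exact ⟨h1, h2, h3, (length_fail_lt L hu0).trans h4⟩
  · rintro ⟨h1, h2, h3, h4⟩
    by_cases hvu : v = u
    · exact .inl hvu
    · refine .inr ⟨h1, h2, h3, ?_⟩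
      by_contra! hle
      exact h4.not_ge (suffix_fail h1 (suffix_of_suffix_of_length_le h2 hus hle) hvu).length_le

end Strings

/-! ### Insertion of the strings into a trie -/

section TrieArrays

variable {σ : ℕ}

/-- The arrays `G`, `SZ`, `PAR`, `ST`, `LN` store the trie of the strings in `M`: node `w` has
number `ν w`, one of `0, σ + 1, …, (n - 1) * (σ + 1)`, its child for letter `a` is in cell
`ν w + a` of `G`, the number of strings below it in `SZ`, its parent in `PAR`, and the start of an
occurrence in the text `T` and its length in `ST` and `LN`. -/
structure Trie (M : List (List (Fin σ))) (T : List (Fin σ)) (ν : List (Fin σ) → ℕ) (n : ℕ)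
    (G SZ PAR ST LN : ℕ → ℕ) : Prop where
  nil : ν [] = 0
  mult : ∀ u, IsNode M u → ∃ j < n, ν u = (σ + 1) * j
  inj : ∀ u v, IsNode M u → IsNode M v → ν u = ν v → u = v
  child : ∀ u (a : Fin σ), IsNode M (u ++ [a]) → G (ν u + a) = ν (u ++ [a])
  leaf : ∀ u (a : Fin σ), IsNode M u → ¬ IsNode M (u ++ [a]) → G (ν u + a) = 0
  size : ∀ u, IsNode M u → SZ (ν u) = size M u
  parent : ∀ u (a : Fin σ), IsNode M (u ++ [a]) → PAR (ν (u ++ [a])) = ν u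
  start : ∀ u, IsNode M u → (T.drop (ST (ν u))).take u.length = u
  len : ∀ u, IsNode M u → LN (ν u) = u.length
  freshChild : ∀ x, (σ + 1) * n ≤ x → G x = 0
  freshSize : ∀ x, (σ + 1) * n ≤ x → SZ x = 0

namespace Trie

variable {M : List (List (Fin σ))} {T x : List (Fin σ)} {ν : List (Fin σ) → ℕ} {n st : ℕ}
  {G SZ PAR ST LN : ℕ → ℕ} {a : Fin σ}

theorem add_lt (h : Trie M T ν n G SZ PAR ST LN) {u : List (Fin σ)} (hu : IsNode M u)
    (a : ℕ) (ha : a ≤ σ) : ν u + a < (σ + 1) * n := by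
  obtain ⟨j, hj, hνu⟩ := h.mult u hu
  have : (σ + 1) * (j + 1) ≤ (σ + 1) * n := Nat.mul_le_mul_left _ hj
  lia

theorem lt (h : Trie M T ν n G SZ PAR ST LN) {u : List (Fin σ)} (hu : IsNode M u) :
    ν u < (σ + 1) * n :=
  h.add_lt hu 0 (Nat.zero_le _)

/-- Numbers are multiples of `σ + 1`, so division by `σ + 1` recovers the row. The numbers come
already multiplied because the machine only adds; the stride is positive even for `σ = 0`. -/
theorem row_inj (h : Trie M T ν n G SZ PAR ST LN) {u v : List (Fin σ)} (hu : IsNode M u)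
    (hv : IsNode M v) {a b : ℕ} (ha : a ≤ σ) (hb : b ≤ σ) (he : ν u + a = ν v + b) :
    u = v ∧ a = b := by
  obtain ⟨i, -, hi⟩ := h.mult u hu
  obtain ⟨j, -, hj⟩ := h.mult v hv
  rw [hi, hj] at he
  have h1 := congrArg (· / (σ + 1)) he
  simp only [Nat.mul_add_div (Nat.succ_pos σ), Nat.div_eq_of_lt (Nat.lt_succ_of_le ha),
    Nat.div_eq_of_lt (Nat.lt_succ_of_le hb), Nat.add_zero] at h1
  subst h1
  exact ⟨h.inj u v hu hv (hi.trans hj.symm), by lia⟩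

theorem eq_zero_iff (h : Trie M T ν n G SZ PAR ST LN) {u : List (Fin σ)} (hu : IsNode M u) :
    ν u = 0 ↔ u = [] :=
  ⟨fun h0 => h.inj u [] hu (isNode_nil M) (h0.trans h.nil.symm), fun h0 => h0 ▸ h.nil⟩

/-- The root has number `0` and is nobody's child, so `0` serves as the null pointer. -/
theorem child_ne_zero_iff (h : Trie M T ν n G SZ PAR ST LN) {u : List (Fin σ)}
    (hu : IsNode M u) (a : Fin σ) : G (ν u + a) ≠ 0 ↔ IsNode M (u ++ [a]) := by
  by_cases hn : IsNode M (u ++ [a])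
  · simp [hn, h.child u a hn, h.eq_zero_iff hn]
  · simp [hn, h.leaf u a hu hn]

end Trie

theorem isNode_append_nil {M : List (List (Fin σ))} {w : List (Fin σ)} :
    IsNode (M ++ [[]]) w ↔ IsNode M w := by
  simp only [IsNode, List.mem_append, List.mem_singleton, or_and_right, exists_or,
    exists_eq_left, List.prefix_nil]
  grind

theorem size_append_nil (M : List (List (Fin σ))) (w : List (Fin σ)) :
    size (M ++ [[]]) w = size M w + if w = [] then 1 else 0 := by
  simp [size, List.countP_cons]

theorem isNode_extend {M : List (List (Fin σ))} {x w : List (Fin σ)} {a : Fin σ} :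
    IsNode (M ++ [x ++ [a]]) w ↔ IsNode (M ++ [x]) w ∨ w = x ++ [a] := by
  simp only [IsNode, List.mem_append, List.mem_singleton, or_and_right, exists_or,
    exists_eq_left, List.prefix_concat_iff]
  grind

theorem size_extend (M : List (List (Fin σ))) (x w : List (Fin σ)) (a : Fin σ) :
    size (M ++ [x ++ [a]]) w = size (M ++ [x]) w + if w = x ++ [a] then 1 else 0 := by
  have : ¬ (x ++ [a] <+: x) := fun h => by simpa using h.length_le
  by_cases hw : w = x ++ [a]
  · subst hw
    simp [size, this]
  · simp [size, List.countP_cons, List.prefix_concat_iff, hw]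

theorem size_eq_zero {M : List (List (Fin σ))} {w : List (Fin σ)} (h : ¬ IsNode M w) :
    size M w = 0 := by
  refine List.countP_eq_zero.2 fun t ht => ?_
  simpa using fun hw => h (.inr ⟨t, ht, hw⟩)

namespace Trie

variable {M : List (List (Fin σ))} {T x : List (Fin σ)} {ν : List (Fin σ) → ℕ} {n st : ℕ}
  {G SZ PAR ST LN : ℕ → ℕ} {a : Fin σ}

/-- A string enters the trie as the empty string and is then extended letter by letter, so that
every node passed has its count raised once. -/
theorem append_nil (h : Trie M T ν n G SZ PAR ST LN) :
    Trie (M ++ [[]]) T ν n G (Function.update SZ 0 (SZ 0 + 1)) PAR ST LN where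
  nil := h.nil
  mult u hu := h.mult u (isNode_append_nil.1 hu)
  inj u v hu hv := h.inj u v (isNode_append_nil.1 hu) (isNode_append_nil.1 hv)
  child u a hu := h.child u a (isNode_append_nil.1 hu)
  leaf u a hu hn := h.leaf u a (isNode_append_nil.1 hu) (mt isNode_append_nil.2 hn)
  size u hu := by
    have hu := isNode_append_nil.1 hu
    have h1 := h.size u hu
    have h2 := h.eq_zero_iff hu
    rw [size_append_nil, Function.update_apply]
    by_cases h0 : u = []
    · have h3 := h2.2 h0
      rw [h3] at h1
      simp [h0, h.nil, h1]
    · simp [h0, mt h2.1 h0, h1]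
  parent u a hu := h.parent u a (isNode_append_nil.1 hu)
  start u hu := h.start u (isNode_append_nil.1 hu)
  len u hu := h.len u (isNode_append_nil.1 hu)
  freshChild := h.freshChild
  freshSize y hy := by
    have := h.lt (isNode_nil M)
    rw [Function.update_of_ne (by lia), h.freshSize y hy]

theorem extend_old (h : Trie (M ++ [x]) T ν n G SZ PAR ST LN)
    (hn : IsNode (M ++ [x]) (x ++ [a])) :
    Trie (M ++ [x ++ [a]]) T ν n G
      (Function.update SZ (ν (x ++ [a])) (SZ (ν (x ++ [a])) + 1)) PAR ST LN := by
  have hiff : ∀ w, IsNode (M ++ [x ++ [a]]) w ↔ IsNode (M ++ [x]) w := fun w =>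
    isNode_extend.trans ⟨fun hw => hw.elim id fun hw => hw ▸ hn, .inl⟩
  refine ⟨h.nil, fun u hu => h.mult u ((hiff u).1 hu),
    fun u v hu hv => h.inj u v ((hiff u).1 hu) ((hiff v).1 hv),
    fun u a hu => h.child u a ((hiff _).1 hu),
    fun u a hu hn => h.leaf u a ((hiff _).1 hu) (mt (hiff _).2 hn), fun u hu => ?_,
    fun u a hu => h.parent u a ((hiff _).1 hu), fun u hu => h.start u ((hiff _).1 hu),
    fun u hu => h.len u ((hiff _).1 hu), h.freshChild, fun y hy => ?_⟩
  · have hu := (hiff u).1 hu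
    rw [size_extend, Function.update_apply]
    by_cases hux : u = x ++ [a]
    · simp [hux, h.size _ hn]
    · simp [hux, mt (h.inj u _ hu hn) hux, h.size u hu]
  · have := h.lt hn
    rw [Function.update_of_ne (by lia), h.freshSize y hy]

/-- The new node takes the first unused row; `freshChild` and `freshSize` say that this row is still
zero, i.e. has no children and count `0`. -/
theorem extend_new (h : Trie (M ++ [x]) T ν n G SZ PAR ST LN)
    (hn : ¬ IsNode (M ++ [x]) (x ++ [a])) (hT : (T.drop st).take (x.length + 1) = x ++ [a]) :
    Trie (M ++ [x ++ [a]]) T (Function.update ν (x ++ [a]) ((σ + 1) * n)) (n + 1)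
      (Function.update G (ν x + a) ((σ + 1) * n))
      (Function.update SZ ((σ + 1) * n) (SZ ((σ + 1) * n) + 1))
      (Function.update PAR ((σ + 1) * n) (ν x)) (Function.update ST ((σ + 1) * n) st)
      (Function.update LN ((σ + 1) * n) (x.length + 1)) := by
  have hx : IsNode (M ++ [x]) x := .of_mem (by simp)
  have hold : ∀ w, IsNode (M ++ [x]) w →
      Function.update ν (x ++ [a]) ((σ + 1) * n) w = ν w := fun w hw =>
    Function.update_of_ne (fun h' : w = x ++ [a] => hn (h' ▸ hw)) _ _
  have hne : ∀ w, IsNode (M ++ [x]) w → ν w ≠ (σ + 1) * n := fun w hw => (h.lt hw).ne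
  have hxa := h.add_lt hx a a.2.le
  have hext : ∀ b, ¬ IsNode (M ++ [x ++ [a]]) (x ++ [a] ++ [b]) := fun b hb => by
    rcases isNode_extend.1 hb with hb | hb
    · exact hn (hb.of_append)
    · simpa using congrArg List.length hb
  have hmul : (σ + 1) * (n + 1) = (σ + 1) * n + (σ + 1) := Nat.mul_succ _ _
  refine ⟨?_, fun u hu => ?_, fun u v hu hv he => ?_, fun u b hu => ?_, fun u b hu hub => ?_,
    fun u hu => ?_, fun u b hu => ?_, fun u hu => ?_, fun u hu => ?_, fun y hy => ?_,
    fun y hy => ?_⟩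
  · rw [hold _ (isNode_nil _), h.nil]
  · rcases isNode_extend.1 hu with hu | rfl
    · obtain ⟨j, hj, he⟩ := h.mult u hu
      exact ⟨j, by lia, by rw [hold u hu, he]⟩
    · exact ⟨n, by lia, by simp⟩
  · rcases isNode_extend.1 hu with hu | rfl <;> rcases isNode_extend.1 hv with hv | rfl
    · rw [hold u hu, hold v hv] at he
      exact h.inj u v hu hv he
    · rw [hold u hu, Function.update_self] at he
      exact (hne u hu he).elim
    · rw [hold v hv, Function.update_self] at he
      exact (hne v hv he.symm).elim
    · rfl
  · rcases isNode_extend.1 hu with hu | he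
    · rw [hold _ hu, hold u hu.of_append, Function.update_of_ne, h.child u b hu]
      intro he
      obtain ⟨rfl, hba⟩ := h.row_inj hu.of_append hx b.2.le a.2.le he
      exact hn (Fin.ext hba ▸ hu)
    · obtain ⟨rfl, rfl⟩ := List.append_singleton_inj.1 he
      rw [hold _ hx, Function.update_self, Function.update_self]
  · rcases isNode_extend.1 hu with hu | rfl
    · rw [hold u hu, Function.update_of_ne,
        h.leaf u b hu (fun h' => hub (isNode_extend.2 (.inl h')))]
      intro he
      obtain ⟨rfl, hba⟩ := h.row_inj hu hx b.2.le a.2.le he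
      exact hub (Fin.ext hba ▸ isNode_extend.2 (.inr rfl))
    · rw [Function.update_self, Function.update_of_ne (by lia), h.freshChild _ (by lia)]
  · rcases isNode_extend.1 hu with hu | rfl
    · rw [hold u hu, Function.update_of_ne (hne u hu), h.size u hu, size_extend,
        if_neg (fun h' : u = x ++ [a] => hn (h' ▸ hu)), Nat.add_zero]
    · rw [Function.update_self, Function.update_self, h.freshSize _ le_rfl, size_extend,
        if_pos rfl, size_eq_zero hn]
  · rcases isNode_extend.1 hu with hu | he
    · rw [hold _ hu, hold u hu.of_append, Function.update_of_ne (hne _ hu), h.parent u b hu]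
    · obtain ⟨rfl, rfl⟩ := List.append_singleton_inj.1 he
      rw [hold _ hx, Function.update_self, Function.update_self]
  · rcases isNode_extend.1 hu with hu | rfl
    · rw [hold u hu, Function.update_of_ne (hne u hu), h.start u hu]
    · rw [Function.update_self, Function.update_self, List.length_append, List.length_singleton,
        hT]
  · rcases isNode_extend.1 hu with hu | rfl
    · rw [hold u hu, Function.update_of_ne (hne u hu), h.len u hu]
    · rw [Function.update_self, Function.update_self, List.length_append, List.length_singleton]
  · rw [Function.update_of_ne (by lia), h.freshChild y (by lia)]
  · rw [Function.update_of_ne (by lia), h.freshSize y (by lia)]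

end Trie

end TrieArrays

/-! ### The program that builds the trie -/

section Insertion

variable {σ : ℕ}

/-- The registers and arrays that are never overwritten before the output is written. -/
structure Consts (L : List (List (Fin σ))) (s : State) : Prop where
  reg0 : s.reg 0 = L.length
  reg1 : s.reg 1 = 0
  reg2 : s.reg 2 = 1
  reg3 : s.reg 3 = σ + 1
  reg4 : s.reg 4 = σ
  lengths : s.arr 0 = (inputState L).arr 0
  text : s.arr 1 = (inputState L).arr 1

theorem Consts.of_agrees {L : List (List (Fin σ))} {p : Prog} {s s' : State} (h : Consts L s)
    (hA : Agrees p s s') (hr : ∀ r < 5, writesReg p r = false)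
    (ha : ∀ a < 2, writesArr p a = false) : Consts L s' :=
  ⟨(hA.1 0 (hr 0 (by lia))).trans h.1, (hA.1 1 (hr 1 (by lia))).trans h.2,
    (hA.1 2 (hr 2 (by lia))).trans h.3, (hA.1 3 (hr 3 (by lia))).trans h.4,
    (hA.1 4 (hr 4 (by lia))).trans h.5, (hA.2 0 (ha 0 (by lia))).trans h.6,
    (hA.2 1 (ha 1 (by lia))).trans h.7⟩

theorem Consts.length_getElem {L : List (List (Fin σ))} {s : State} (h : Consts L s) {i : ℕ}
    (hi : i < L.length) : s.arr 0 i = L[i].length := by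
  rw [h.lengths]
  simp [inputState, hi]

theorem Consts.letter {L : List (List (Fin σ))} {s : State} (h : Consts L s) {j : ℕ}
    (hj : j < L.flatten.length) : s.arr 1 j = L.flatten[j] := by
  rw [h.text]
  change (L.flatten.map Fin.val).getD j 0 = _
  rw [List.getD_eq_getElem _ _ (by rwa [List.length_map]), List.getElem_map]

/-- The machine has enough words for the list `L`. -/
structure WordBound (L : List (List (Fin σ))) (W : ℕ) : Prop where
  le : (σ + 1) * (L.flatten.length + 3) ≤ W
  length_le : L.length ≤ L.flatten.length + 1

theorem WordBound.lt {L : List (List (Fin σ))} {W : ℕ} (h : WordBound L W) :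
    L.flatten.length + 2 < W := by
  have := h.le
  nlinarith

theorem WordBound.mul_lt {L : List (List (Fin σ))} {W n x : ℕ} (h : WordBound L W)
    (hn : n ≤ L.flatten.length + 2) (hx : x ≤ (σ + 1) * n) : x < W := by
  have h1 := h.le
  have h2 : (σ + 1) * n ≤ (σ + 1) * (L.flatten.length + 2) := Nat.mul_le_mul_left _ hn
  have h3 : (σ + 1) * (L.flatten.length + 3) = (σ + 1) * (L.flatten.length + 2) + (σ + 1) :=
    Nat.mul_succ _ _
  lia

/-- The position of string number `i` in the concatenation of `L`. -/
def pos (L : List (List (Fin σ))) (i : ℕ) : ℕ := (L.take i).flatten.length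

theorem pos_succ {L : List (List (Fin σ))} {i : ℕ} (hi : i < L.length) :
    pos L (i + 1) = pos L i + L[i].length := by
  rw [pos, pos, List.take_add_one, List.getElem?_eq_getElem hi, List.flatten_append,
    List.length_append]
  simp

theorem flatten_eq {L : List (List (Fin σ))} {i : ℕ} (hi : i < L.length) :
    L.flatten = (L.take i).flatten ++ (L[i] ++ (L.drop (i + 1)).flatten) := by
  rw [← List.flatten_cons, ← List.flatten_append, ← List.drop_eq_getElem_cons hi,
    List.take_append_drop]

theorem pos_add_le {L : List (List (Fin σ))} {i : ℕ} (hi : i < L.length) :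
    pos L i + L[i].length ≤ L.flatten.length := by
  rw [flatten_eq hi]
  simp [pos]

theorem getElem_flatten {L : List (List (Fin σ))} {i d : ℕ} (hi : i < L.length)
    (hd : d < L[i].length) :
    L.flatten[pos L i + d]'(by have := pos_add_le hi; lia) = L[i][d] := by
  simp only [flatten_eq hi]
  rw [List.getElem_append_right (by simp [pos])]
  simp [pos, List.getElem_append_left, hd]

theorem take_drop_flatten {L : List (List (Fin σ))} {i d : ℕ} (hi : i < L.length)
    (hd : d ≤ L[i].length) : (L.flatten.drop (pos L i)).take d = L[i].take d := by
  rw [flatten_eq hi, pos, List.drop_left, List.take_append_of_le_length hd]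

/-- Insertion of the next letter of a string into the trie. -/
def letterStep : Prog := block
  -- Register 6 is the text position, 9 the start of the current string, 10 the current node and 7
  -- the last number given out. Position 6 is advanced first, so `6 - 9` is the depth of the child.
  -- The last three instructions raise the child's count.
  [.load 12 1 6, .add 6 6 2, .add 13 10 12, .load 14 6 13,
    .ite (.eq 14 1)
      (block [.add 7 7 3, .copy 14 7, .store 6 13 14, .store 8 14 10, .store 9 14 9,
        .sub 15 6 9, .store 10 14 15]) .skip,
    .copy 10 14, .load 15 7 10, .add 15 15 2, .store 7 10 15]

/-- The preparation for the insertion of the next string. -/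
def stringStart : Prog := block
  [.load 8 0 5, .copy 9 6, .add 11 6 8, .copy 10 1, .load 15 7 10, .add 15 15 2, .store 7 10 15]

/-- The end of the insertion of a string. -/
def stringEnd : Prog := block [.store 11 5 10, .add 5 5 2]

/-- Insertion of all strings into the trie. -/
def insertStrings : Prog :=
  .while (.lt 5 0) (.seq stringStart (.seq (.while (.lt 6 11) letterStep) stringEnd))

/-- The memory stores the trie of the strings in `M`. -/
structure StoresTrie (L M : List (List (Fin σ))) (ν : List (Fin σ) → ℕ) (n : ℕ) (s : State) :
    Prop where
  trie : Trie M L.flatten ν n (s.arr 6) (s.arr 7) (s.arr 8) (s.arr 9) (s.arr 10)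
  next : s.reg 7 + (σ + 1) = (σ + 1) * n
  le : n ≤ s.reg 6 + 1

/-- The state of the memory when `d` letters of string number `i` have been inserted. -/
def Inserting (L : List (List (Fin σ))) (i : ℕ) (x : List (Fin σ)) (s : State) : Prop :=
  ∃ ν n, StoresTrie L (L.take i ++ [x]) ν n s ∧ s.reg 10 = ν x ∧
    s.reg 6 = pos L i + x.length ∧ ∀ j (hj : j < L.length), j < i → s.arr 11 j = ν L[j]

theorem letterStep_runs {L : List (List (Fin σ))} {W : ℕ} (hW : WordBound L W) {s : State}
    (hc : Consts L s) {i d : ℕ} (hi : i < L.length) (hd : d < L[i].length)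
    (h : Inserting L i (L[i].take d) s) (h9 : s.reg 9 = pos L i) :
    Runs W letterStep s (cost letterStep) (Inserting L i (L[i].take (d + 1))) := by
  obtain ⟨ν, n, ⟨ht, h7, hn⟩, h10, h6, h11⟩ := h
  have hxl : (L[i].take d).length = d := by simp; lia
  have hp := pos_add_le hi
  rw [hxl] at h6
  have hletter : s.arr 1 (pos L i + d) = L[i][d] := by
    rw [hc.letter (by lia), getElem_flatten hi hd]
  have hx1 : L[i].take (d + 1) = L[i].take d ++ [L[i][d]] := by simp [hd]
  have hTx : (L.flatten.drop (pos L i)).take ((L[i].take d).length + 1) =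
      L[i].take d ++ [L[i][d]] := by rw [hxl, take_drop_flatten hi hd, hx1]
  generalize hx : L[i].take d = x at *
  generalize ha : L[i][d] = a at *
  have hxn : IsNode (L.take i ++ [x]) x := .of_mem (by simp)
  have hlt := ht.add_lt hxn a a.2.le
  have hWlt := hW.lt
  have hle := hW.length_le
  refine Runs.of_wp letterStep ?_
  rw [hx1]
  simp only [letterStep, block, wp, Test.Holds, State.reg_setReg, State.arr_setReg,
    State.reg_setArr, State.arr_setArr]
  simp [hc.reg1, hc.reg2, hc.reg3, h10, h6, h9, h7, hletter]
  have hbound : ∀ y, y ≤ (σ + 1) * n → y < W := fun y hy => hW.mul_lt (by lia) hy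
  refine ⟨by lia, by lia, hbound _ hlt.le, fun h0 => ?_, fun h0 => ?_⟩
  · have hn' : ¬ IsNode (L.take i ++ [x]) (x ++ [a]) := fun h' =>
      (ht.child_ne_zero_iff hxn a).2 h' h0
    have h1 := ht.extend_new hn' hTx
    refine ⟨hbound _ le_rfl, hbound _ hlt.le, hbound _ le_rfl, ?_, hbound _ le_rfl,
      Function.update ν (x ++ [a]) ((σ + 1) * n), n + 1, ⟨?_, ?_, ?_⟩, ?_, ?_, fun j hj hji => ?_⟩
    · rw [ht.freshSize _ le_rfl]
      lia
    · simpa [State.reg_setReg, State.arr_setReg, State.reg_setArr, State.arr_setArr,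
        Nat.add_assoc, hxl] using h1
    · simp [State.reg_setReg, State.reg_setArr, Nat.mul_succ]
    · simp [State.reg_setReg, State.reg_setArr]
      lia
    · simp [State.reg_setReg, State.reg_setArr]
    · simp [State.reg_setReg, State.reg_setArr, hxl, Nat.add_assoc]
    · have : L[j] ≠ x ++ [a] := fun he => hn' (.of_mem (List.mem_append_left _
        (he ▸ List.mem_take_iff_getElem.2 ⟨j, by lia, rfl⟩)))
      simp [State.arr_setReg, State.arr_setArr, Function.update_of_ne this, h11 j hj hji]
  · have hn' := (ht.child_ne_zero_iff hxn a).1 h0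
    have h1 := ht.extend_old hn'
    rw [ht.child x a hn'] at h0 ⊢
    have hb := hbound _ (ht.lt hn').le
    refine ⟨hb, ?_, hb, ν, n, ⟨?_, ?_, ?_⟩, ?_, ?_, fun j hj hji => ?_⟩
    · rw [ht.size _ hn']
      have := size_le_length (L.take i ++ [x]) (x ++ [a])
      simp only [List.length_append, List.length_take, List.length_singleton] at this
      lia
    · simpa [State.reg_setReg, State.arr_setReg, State.reg_setArr, State.arr_setArr] using h1
    · simp [State.reg_setReg, State.reg_setArr, h7]
    · simp [State.reg_setReg, State.reg_setArr]
      lia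
    · simp [State.reg_setReg, State.reg_setArr]
    · simp [State.reg_setReg, State.reg_setArr, hxl, Nat.add_assoc]
    · simp [State.arr_setReg, State.arr_setArr, h11 j hj hji]

theorem stringStart_runs {L : List (List (Fin σ))} {W : ℕ} (hW : WordBound L W) {s : State}
    (hc : Consts L s) {i : ℕ} (hi : i < L.length) {ν : List (Fin σ) → ℕ} {n : ℕ}
    (ht : StoresTrie L (L.take i) ν n s) (h5 : s.reg 5 = i) (h6 : s.reg 6 = pos L i)
    (h11 : ∀ j (hj : j < L.length), j < i → s.arr 11 j = ν L[j]) :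
    Runs W stringStart s (cost stringStart) (fun s' => Inserting L i [] s' ∧
      s'.reg 9 = pos L i ∧ s'.reg 11 = pos L i + L[i].length) := by
  obtain ⟨ht, h7, hn⟩ := ht
  have hp := pos_add_le hi
  have hWlt := hW.lt
  have hle := hW.length_le
  have hlen := hc.length_getElem hi
  have h1 := ht.append_nil
  refine Runs.of_wp stringStart ?_
  simp only [stringStart, block, wp, Test.Holds, State.reg_setReg, State.arr_setReg,
    State.reg_setArr, State.arr_setArr]
  simp [hc.reg1, hc.reg2, h5, h6, hlen]
  have hsz : s.arr 7 0 + 1 < W := by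
    have h2 := ht.size [] (isNode_nil _)
    rw [ht.nil] at h2
    have := size_le_length (L.take i) ([] : List (Fin σ))
    simp only [List.length_take] at this
    lia
  refine ⟨by lia, by lia, by lia, hsz, by lia, ν, n, ⟨?_, ?_, ?_⟩, ?_, ?_, fun j hj hji => ?_⟩
  · simpa [State.reg_setReg, State.arr_setReg, State.reg_setArr, State.arr_setArr] using h1
  · simp [State.reg_setReg, State.reg_setArr, h7]
  · simpa [State.reg_setReg, State.reg_setArr] using hn
  · simp [State.reg_setReg, State.reg_setArr, ht.nil]
  · simp [State.reg_setReg, State.reg_setArr, h6]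
  · simp [State.arr_setReg, State.arr_setArr, h11 j hj hji]

theorem stringEnd_runs {L : List (List (Fin σ))} {W : ℕ} (hW : WordBound L W) {s : State}
    (hc : Consts L s) {i : ℕ} (hi : i < L.length) (h : Inserting L i L[i] s)
    (h5 : s.reg 5 = i) :
    Runs W stringEnd s (cost stringEnd) (fun s' => (∃ ν n,
      StoresTrie L (L.take (i + 1)) ν n s' ∧
        ∀ j (hj : j < L.length), j < i + 1 → s'.arr 11 j = ν L[j]) ∧
      s'.reg 5 = i + 1 ∧ s'.reg 6 = pos L (i + 1)) := by
  obtain ⟨ν, n, ⟨ht, h7, hn⟩, h10, h6, h11⟩ := h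
  have hWlt := hW.lt
  have hle := hW.length_le
  rw [← pos_succ hi] at h6
  have htake : L.take i ++ [L[i]] = L.take (i + 1) := by
    rw [List.take_add_one, List.getElem?_eq_getElem hi, Option.toList_some]
  refine Runs.of_wp stringEnd ?_
  simp only [stringEnd, block, wp, Test.Holds, State.reg_setReg, State.arr_setReg,
    State.reg_setArr, State.arr_setArr]
  simp [hc.reg2, h5, h6, h10]
  refine ⟨by lia, by lia, ν, ⟨n, ⟨?_, ?_, ?_⟩⟩, fun j hj hji => ?_⟩
  · rw [← htake]
    simpa [State.arr_setReg, State.arr_setArr] using ht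
  · simpa [State.reg_setReg, State.reg_setArr] using h7
  · simpa [State.reg_setReg, State.reg_setArr] using hn
  · rcases hji.lt_or_eq with hji | rfl
    · simp [Function.update_of_ne hji.ne, h11 j hj hji]
    · simp

theorem insertLetters_runs {L : List (List (Fin σ))} {W : ℕ} (hW : WordBound L W) {s : State}
    (hc : Consts L s) {i : ℕ} (hi : i < L.length) (h : Inserting L i [] s)
    (h9 : s.reg 9 = pos L i) (h11 : s.reg 11 = pos L i + L[i].length) :
    Runs W (.while (.lt 6 11) letterStep) s (L[i].length * (cost letterStep + 1) + 1)
      (Inserting L i L[i]) := by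
  have h6 : s.reg 6 = pos L i := by
    obtain ⟨ν, n, -, -, h6, -⟩ := h
    simpa using h6
  refine (Runs.loop (W := W) (b := .lt 6 11) (s₀ := s) (p := letterStep)
    (fun s => ∃ d ≤ L[i].length, Inserting L i (L[i].take d) s)
    (fun s => (pos L i + L[i].length - s.reg 6) * (cost letterStep + 1)) ?_
    ⟨0, Nat.zero_le _, by simpa using h⟩).mono ?_ ?_
  · rintro s' hA ⟨d, hd, hI⟩ hb
    have hI6 : s'.reg 6 = pos L i + d := by
      obtain ⟨ν, n, -, -, h6, -⟩ := hI
      simpa [hd] using h6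
    simp only [Test.Holds, hI6, hA.1 11 rfl, h11] at hb
    have hlt : d < L[i].length := by lia
    refine ⟨_, (letterStep_runs hW (hc.of_agrees hA (by decide) (by decide)) hi hlt hI
      ((hA.1 9 rfl).trans h9)).mono le_rfl fun s'' h'' => ⟨⟨d + 1, hlt, h''⟩, ?_⟩⟩
    obtain ⟨ν, n, -, -, h6, -⟩ := h''
    have h6 : s''.reg 6 = pos L i + (d + 1) := by
      rw [h6, List.length_take_of_le hlt]
    rw [h6, hI6, show pos L i + L[i].length - (pos L i + d) =
      pos L i + L[i].length - (pos L i + (d + 1)) + 1 by lia]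
    lia
  · simp [h6]
  · rintro s' ⟨⟨d, hd, hI⟩, hb, hA⟩
    have hI6 : s'.reg 6 = pos L i + d := by
      obtain ⟨ν, n, -, -, h6, -⟩ := hI
      simpa [hd] using h6
    simp only [Test.Holds, hI6, hA.1 11 rfl, h11] at hb
    rwa [show d = L[i].length by lia, List.take_length] at hI

theorem trie_nil (T : List (Fin σ)) : Trie [] T (fun _ => 0) 1 (fun _ => 0) (fun _ => 0)
    (fun _ => 0) (fun _ => 0) (fun _ => 0) := by
  have h : ∀ w : List (Fin σ), IsNode [] w ↔ w = [] := by simp [IsNode]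
  constructor <;> simp [h, size]

theorem pos_length (L : List (List (Fin σ))) : pos L L.length = L.flatten.length := by
  simp [pos]

theorem insertStrings_runs {L : List (List (Fin σ))} {W : ℕ} (hW : WordBound L W) {s : State}
    (hc : Consts L s) (h5 : s.reg 5 = 0) (h6 : s.reg 6 = 0) (h7 : s.reg 7 = 0)
    (h : ∀ a, 6 ≤ a → a ≤ 10 → s.arr a = fun _ => 0) :
    Runs W insertStrings s (L.flatten.length * (cost letterStep + 1) +
        L.length * (cost stringStart + cost stringEnd + 2) + 1)
      (fun s' => ∃ ν n, n ≤ L.flatten.length + 1 ∧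
        Trie L L.flatten ν n (s'.arr 6) (s'.arr 7) (s'.arr 8) (s'.arr 9) (s'.arr 10) ∧
        ∀ j (hj : j < L.length), s'.arr 11 j = ν L[j]) := by
  refine (Runs.loop (W := W) (b := .lt 5 0) (s₀ := s)
    (p := .seq stringStart (.seq (.while (.lt 6 11) letterStep) stringEnd))
    (fun s => ∃ i ≤ L.length, (∃ ν n, StoresTrie L (L.take i) ν n s ∧
        ∀ j (hj : j < L.length), j < i → s.arr 11 j = ν L[j]) ∧
      s.reg 5 = i ∧ s.reg 6 = pos L i)
    -- Every letter pays for its own insertion and every string for its start and end.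
    (fun s => (L.flatten.length - s.reg 6) * (cost letterStep + 1) +
        (L.length - s.reg 5) * (cost stringStart + cost stringEnd + 2)) ?_ ?_).mono ?_ ?_
  · rintro s' hA ⟨i, hi, ⟨ν, n, ht, he⟩, hi5, hi6⟩ hb
    have hc' := hc.of_agrees hA (by decide) (by decide)
    simp only [Test.Holds, hi5, hc'.reg0] at hb
    refine ⟨cost stringStart + (L[i].length * (cost letterStep + 1) + 1 + cost stringEnd),
      Runs.seq ((stringStart_runs hW hc' hb ht hi5 hi6 he).frame.mono le_rfl ?_)⟩
    rintro s₁ ⟨⟨hI₁, h9₁, h11₁⟩, hA₁⟩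
    have hc₁ := hc'.of_agrees hA₁ (by decide) (by decide)
    refine Runs.seq ((insertLetters_runs hW hc₁ hb hI₁ h9₁ h11₁).frame.mono le_rfl ?_)
    rintro s₂ ⟨hI₂, hA₂⟩
    refine (stringEnd_runs hW (hc₁.of_agrees hA₂ (by decide) (by decide)) hb hI₂
      (((hA₂.1 5 rfl).trans (hA₁.1 5 rfl)).trans hi5)).mono le_rfl ?_
    rintro s₃ ⟨h₁, h₂, h₃⟩
    refine ⟨⟨i + 1, hb, h₁, h₂, h₃⟩, ?_⟩
    have hp := pos_add_le hb
    rw [h₂, h₃, hi5, hi6, pos_succ hb, show L.length - i = L.length - (i + 1) + 1 by lia,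
      show L.flatten.length - pos L i =
        L.flatten.length - (pos L i + L[i].length) + L[i].length by lia]
    lia
  · refine ⟨0, Nat.zero_le _, ⟨fun _ => 0, 1, ⟨?_, ?_, ?_⟩, by simp⟩, h5, by simp [h6, pos]⟩
    · simp only [h _ (le_refl 6) (by lia), h 7 (by lia) (by lia), h 8 (by lia) (by lia),
        h 9 (by lia) (by lia), h 10 (by lia) (by lia)]
      exact trie_nil _
    · simp [h7]
    · simp
  · simp [h5, h6]
  · rintro s' ⟨⟨i, hi, ⟨ν, n, ht, he⟩, hi5, hi6⟩, hb, hA⟩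
    simp only [Test.Holds, hi5, (hc.of_agrees hA (by decide) (by decide)).reg0] at hb
    obtain rfl : i = L.length := by lia
    have hn := ht.le
    rw [hi6, pos_length] at hn
    exact ⟨ν, n, hn, by simpa using ht.trie, fun j hj => he j hj hj⟩

end Insertion

section Search

variable {σ : ℕ}

/-! ### Breadth-first search -/

/-- The row entry of node `w` for letter `a` has been computed when the nodes before position `h`
in the queue `q` have been treated completely, and that at position `h` for the first `k` letters. -/
def Done (q : List (List (Fin σ))) (h k : ℕ) (w : List (Fin σ)) (a : Fin σ) : Prop :=
  w ∈ q.take h ∨ q[h]? = some w ∧ a < k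

/-- The queue of a breadth-first search of the trie of `L`. -/
structure Queue (L q : List (List (Fin σ))) (h k : ℕ) : Prop where
  isNode : ∀ w ∈ q, IsNode L w
  nodup : q.Nodup
  sorted : q.Pairwise fun v w => v.length ≤ w.length
  zero : q[0]? = some []
  closed : ∀ w a, IsNode L (w ++ [a]) → (w ++ [a] ∈ q ↔ Done q h k w a)

theorem Done.mem {q : List (List (Fin σ))} {h k : ℕ} {w : List (Fin σ)} {a : Fin σ}
    (hd : Done q h k w a) : w ∈ q :=
  hd.elim List.mem_of_mem_take fun h' => List.mem_of_getElem? h'.1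

theorem done_append {q : List (List (Fin σ))} {h k : ℕ} {v w : List (Fin σ)} {a : Fin σ}
    (hh : h < q.length) : Done (q ++ [v]) h k w a ↔ Done q h k w a := by
  rw [Done, Done, List.take_append_of_le_length hh.le, List.getElem?_append_left hh]

theorem done_succ {q : List (List (Fin σ))} {h : ℕ} {u w : List (Fin σ)} {a b : Fin σ}
    (hu : q[h]? = some u) : Done q h (a + 1) w b ↔ Done q h a w b ∨ w = u ∧ b = a := by
  have : (b : ℕ) < a + 1 ↔ (b : ℕ) < a ∨ b = a := by
    rw [Fin.ext_iff]
    lia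
  simp only [Done, hu, Option.some.injEq, this]
  grind

theorem done_next {q : List (List (Fin σ))} {h : ℕ} {w : List (Fin σ)} {a : Fin σ} :
    Done q (h + 1) 0 w a ↔ Done q h σ w a := by
  simp only [Done, List.take_add_one, List.mem_append, Option.mem_toList, Nat.not_lt_zero,
    and_false, or_false, a.2, and_true]

namespace Queue

variable {L q : List (List (Fin σ))} {h k : ℕ} {u : List (Fin σ)} {a : Fin σ}

theorem length_le (hq : Queue L q h k) (hu : q[h]? = some u) {w : List (Fin σ)}
    (hw : w ∈ q.take h) : w.length ≤ u.length := by
  obtain ⟨i, hi, rfl⟩ := List.mem_take_iff_getElem.1 hw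
  obtain ⟨hh, rfl⟩ := List.getElem?_eq_some_iff.1 hu
  exact List.pairwise_iff_getElem.1 hq.sorted i h (by lia) hh (by lia)

/-- By induction the parent of `w` has been treated, so `w` is in the queue, and sortedness puts it
before `u`. Hence the rows of `fail L u` and `bord u` are complete when a nonempty `u` is treated.
-/
theorem mem_take_of_length_lt (hq : Queue L q h k) (hu : q[h]? = some u) {w : List (Fin σ)}
    (hw : IsNode L w) (hlt : w.length < u.length) : w ∈ q.take h := by
  obtain ⟨hh, hu'⟩ := List.getElem?_eq_some_iff.1 hu
  induction w using List.reverseRecOn with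
  | nil =>
    obtain ⟨h0, h0'⟩ := List.getElem?_eq_some_iff.1 hq.zero
    refine List.mem_take_iff_getElem.2 ⟨0, ?_, h0'⟩
    rcases Nat.eq_zero_or_pos h with rfl | hpos
    · rw [h0'] at hu'
      simp [← hu'] at hlt
    · lia
  | append_singleton w b ih =>
    rw [List.length_append, List.length_singleton] at hlt
    obtain ⟨i, hi, hi'⟩ := List.getElem_of_mem
      ((hq.closed w b hw).2 (.inl (ih hw.of_append (by lia))))
    refine List.mem_take_iff_getElem.2 ⟨i, ?_, hi'⟩
    by_contra! hle
    rcases (show h ≤ i by lia).lt_or_eq with hlt' | rfl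
    · have := List.pairwise_iff_getElem.1 hq.sorted h i hh hi hlt'
      rw [hi', hu', List.length_append, List.length_singleton] at this
      lia
    · rw [hu'] at hi'
      rw [hi', List.length_append, List.length_singleton] at hlt
      lia

theorem not_done (hq : Queue L q h a) (hu : q[h]? = some u) : ¬ Done q h a u a := by
  rintro (h' | h')
  · obtain ⟨i, hi, hi'⟩ := List.mem_take_iff_getElem.1 h'
    obtain ⟨hh, hu'⟩ := List.getElem?_eq_some_iff.1 hu
    have := (hq.nodup.getElem_inj_iff (hi := by lia) (hj := hh)).1 (hi'.trans hu'.symm)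
    lia
  · exact lt_irrefl _ h'.2

theorem notMem (hq : Queue L q h a) (hu : q[h]? = some u) (hn : IsNode L (u ++ [a])) :
    u ++ [a] ∉ q :=
  fun h' => hq.not_done hu ((hq.closed u a hn).1 h')

theorem push (hq : Queue L q h a) (hu : q[h]? = some u) (hn : IsNode L (u ++ [a])) :
    Queue L (q ++ [u ++ [a]]) h (a + 1) := by
  have hh := (List.getElem?_eq_some_iff.1 hu).1
  refine ⟨fun w hw => ?_, ?_, ?_, ?_, fun w b hwb => ?_⟩
  · rcases List.mem_append.1 hw with hw | hw
    · exact hq.isNode w hw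
    · rwa [List.mem_singleton.1 hw]
  · exact hq.nodup.append (List.nodup_singleton _) (by simpa using hq.notMem hu hn)
  · refine List.pairwise_append.2 ⟨hq.sorted, List.pairwise_singleton _ _, fun w hw v hv => ?_⟩
    rw [List.mem_singleton.1 hv, List.length_append, List.length_singleton]
    -- A nonempty queue element was pushed by its parent, which was treated no later than `u` and so
    -- is no longer than `u`.
    induction w using List.reverseRecOn with
    | nil => simp
    | append_singleton w b _ =>
      rw [List.length_append, List.length_singleton, Nat.add_le_add_iff_right]
      rcases (hq.closed w b (hq.isNode _ hw)).1 hw with h' | h'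
      · exact hq.length_le hu h'
      · rw [hu, Option.some.injEq] at h'
        rw [h'.1]
  · rw [List.getElem?_append_left (by lia), hq.zero]
  · rw [done_append hh, done_succ hu, List.mem_append, hq.closed w b hwb, List.mem_singleton,
      List.append_singleton_inj]

theorem skip (hq : Queue L q h a) (hu : q[h]? = some u) (hn : ¬ IsNode L (u ++ [a])) :
    Queue L q h (a + 1) := by
  refine ⟨hq.isNode, hq.nodup, hq.sorted, hq.zero, fun w b hwb => ?_⟩
  rw [done_succ hu, hq.closed w b hwb]
  refine ⟨.inl, fun h' => h'.elim id ?_⟩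
  rintro ⟨rfl, rfl⟩
  exact (hn hwb).elim

theorem next (hq : Queue L q h σ) : Queue L q (h + 1) 0 :=
  ⟨hq.isNode, hq.nodup, hq.sorted, hq.zero, fun w b hwb => by
    rw [done_next, hq.closed w b hwb]⟩

theorem start (L : List (List (Fin σ))) : Queue L [[]] 0 0 :=
  ⟨by simp [isNode_nil], by simp, by simp, rfl, by simp [Done]⟩

theorem mem_iff (hq : Queue L q h k) (hh : q.length ≤ h) {w : List (Fin σ)} :
    w ∈ q ↔ IsNode L w := by
  refine ⟨hq.isNode w, fun hw => ?_⟩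
  induction w using List.reverseRecOn with
  | nil => exact List.mem_of_getElem? hq.zero
  | append_singleton w b ih =>
    refine (hq.closed w b hw).2 (.inl ?_)
    rw [List.take_of_length_le hh]
    exact ih hw.of_append

end Queue

/-- Distinct nodes occupy distinct rows. This bounds the queue and the vertex list, both in time and
in cell indices. -/
theorem Trie.length_le {L : List (List (Fin σ))} {T : List (Fin σ)} {ν : List (Fin σ) → ℕ}
    {n : ℕ} {G SZ PAR ST LN : ℕ → ℕ} (h : Trie L T ν n G SZ PAR ST LN)
    {q : List (List (Fin σ))} (hq : q.Nodup) (hn : ∀ w ∈ q, IsNode L w) : q.length ≤ n := by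
  rw [← List.toFinset_card_of_nodup hq, ← Finset.card_range n]
  refine Finset.card_le_card_of_injOn (fun w => ν w / (σ + 1)) (fun w hw => ?_)
    fun v hv w hw he => ?_
  · obtain ⟨j, hj, he⟩ := h.mult w (hn w (List.mem_toFinset.1 hw))
    simpa [he] using hj
  · have hv := hn v (List.mem_toFinset.1 hv)
    have hw := hn w (List.mem_toFinset.1 hw)
    obtain ⟨i, -, hi⟩ := h.mult v hv
    obtain ⟨j, -, hj⟩ := h.mult w hw
    simp only [hi, hj, Nat.mul_div_cancel_left _ (Nat.succ_pos σ)] at he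
    exact h.inj v w hv hw (by rw [hi, hj, he])

theorem Trie.letter {L : List (List (Fin σ))} {T : List (Fin σ)} {ν : List (Fin σ) → ℕ}
    {n : ℕ} {G SZ PAR ST LN : ℕ → ℕ} (h : Trie L T ν n G SZ PAR ST LN) {u : List (Fin σ)}
    (hu : IsNode L u) {i : ℕ} (hi : i < u.length) :
    ∃ hT : ST (ν u) + i < T.length, T[ST (ν u) + i] = u[i] := by
  have h1 := h.start u hu
  have h2 : ((T.drop (ST (ν u))).take u.length)[i]? = some u[i] := by
    rw [h1, List.getElem?_eq_getElem hi]
  rw [List.getElem?_take_of_lt hi, List.getElem?_drop] at h2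
  exact List.getElem?_eq_some_iff.1 h2

/-- The state of the arrays that are filled by the breadth-first search: the queue, the numbers of
the longest proper suffix that is a node and of the longest border of every node in the queue, and
the rows of the automata. -/
structure SearchArrays (L : List (List (Fin σ))) (ν : List (Fin σ) → ℕ)
    (q : List (List (Fin σ))) (h k : ℕ) (Q F B D A : ℕ → ℕ) : Prop where
  queue : ∀ j (hj : j < q.length), Q j = ν q[j]
  fail : ∀ w ∈ q, F (ν w) = ν (fail L w)
  bord : ∀ w ∈ q, B (ν w) = ν (bord w)
  trans : ∀ w a, Done q h k w a → D (ν w + a) = ν (trans L w a)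
  transNil : ∀ a : Fin σ, ¬ Done q h k [] a → D a = 0
  btrans : ∀ w a, Done q h k w a → A (ν w + a) = ν (btrans w a)
  btransNil : ∀ a : Fin σ, A a = 0

theorem trans_eq_fail {L : List (List (Fin σ))} {u : List (Fin σ)} {a : Fin σ}
    (h : ¬ IsNode L (u ++ [a])) : trans L u a = HOG.fail L (u ++ [a]) := by
  cases u with
  | nil => exact trans_nil_of_not_isNode h
  | cons x u => rw [trans_of_not_isNode (List.cons_ne_nil x u) h, fail_append (by simp)]

namespace SearchArrays

variable {L q : List (List (Fin σ))} {T : List (Fin σ)} {ν : List (Fin σ) → ℕ} {n h k : ℕ}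
  {G SZ PAR ST LN Q F B D A : ℕ → ℕ} {u : List (Fin σ)} {a : Fin σ}

theorem transRow (hs : SearchArrays L ν q h a Q F B D A) (ht : Trie L T ν n G SZ PAR ST LN)
    (hq : Queue L q h a) (hu : q[h]? = some u) :
    D (ν (HOG.fail L u) + a) = ν (HOG.fail L (u ++ [a])) := by
  -- At the root the entry read lies in the very row being written; it is still `0`, the number of
  -- `fail L [a] = []`.
  by_cases h0 : u = []
  · subst h0
    rw [fail_nil, List.nil_append, fail_singleton, ht.nil, Nat.zero_add,
      hs.transNil a (hq.not_done hu)]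
  · rw [fail_append h0]
    exact hs.trans _ _ (.inl (hq.mem_take_of_length_lt hu (isNode_fail L u)
      (length_fail_lt L h0)))

/-- The row of `bord u` is right except at the letter following `bord u` in `u`; there the answer is
the corresponding child of `bord u` in the trie. -/
theorem btransRow (hs : SearchArrays L ν q h a Q F B D A) (ht : Trie L T ν n G SZ PAR ST LN)
    (hq : Queue L q h a) (hu : q[h]? = some u) :
    (if u ≠ [] ∧ HOG.bord u ++ [a] <+: u then G (ν (HOG.bord u) + a)
      else A (ν (HOG.bord u) + a)) = ν (HOG.btrans u a) := by
  have hun := hq.isNode u (List.mem_of_getElem? hu)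
  split_ifs with hc
  · rw [btrans_of_prefix hc.1 hc.2, ht.child _ _ (hun.of_prefix hc.2)]
  · by_cases h0 : u = []
    · subst h0
      rw [bord_nil, btrans_nil, ht.nil, Nat.zero_add, hs.btransNil]
    · rw [btrans_of_not_prefix h0 fun h' => hc ⟨h0, h'⟩]
      exact hs.btrans _ _ (.inl (hq.mem_take_of_length_lt hu (hun.of_prefix (bord_prefix u))
        (length_bord_lt h0)))

theorem push (hs : SearchArrays L ν q h a Q F B D A) (ht : Trie L T ν n G SZ PAR ST LN)
    (hq : Queue L q h a) (hu : q[h]? = some u) (hn : IsNode L (u ++ [a])) :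
    SearchArrays L ν (q ++ [u ++ [a]]) h (a + 1) (Function.update Q q.length (ν (u ++ [a])))
      (Function.update F (ν (u ++ [a])) (ν (HOG.fail L (u ++ [a]))))
      (Function.update B (ν (u ++ [a])) (ν (HOG.btrans u a)))
      (Function.update D (ν u + a) (ν (u ++ [a])))
      (Function.update A (ν u + a) (ν (HOG.btrans u a))) := by
  have hh := (List.getElem?_eq_some_iff.1 hu).1
  have hun := hq.isNode u (List.mem_of_getElem? hu)
  have hmem := hq.notMem hu hn
  have hdone : ∀ w b, Done (q ++ [u ++ [a]]) h (a + 1) w b ↔ Done q h a w b ∨ w = u ∧ b = a :=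
    fun w b => by rw [done_append hh, done_succ hu]
  have hne : ∀ w ∈ q, ν w ≠ ν (u ++ [a]) := fun w hw he =>
    hmem (ht.inj _ _ (hq.isNode w hw) hn he ▸ hw)
  have hrow : ∀ w b, Done q h a w b → ν w + b ≠ ν u + a := fun w b hd he => by
    obtain ⟨rfl, hb⟩ := ht.row_inj (hq.isNode w hd.mem) hun b.2.le a.2.le he
    exact hq.not_done hu (Fin.ext hb ▸ hd)
  refine ⟨fun j hj => ?_, fun w hw => ?_, fun w hw => ?_, fun w b hd => ?_, fun b hd => ?_,
    fun w b hd => ?_, fun b => ?_⟩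
  · rw [List.length_append, List.length_singleton] at hj
    rcases Nat.lt_succ_iff_lt_or_eq.1 hj with hj | rfl
    · rw [Function.update_of_ne hj.ne, hs.queue j hj, List.getElem_append_left hj]
    · simp
  · rcases List.mem_append.1 hw with hw | hw
    · rw [Function.update_of_ne (hne w hw), hs.fail w hw]
    · rw [List.mem_singleton.1 hw, Function.update_self]
  · rcases List.mem_append.1 hw with hw | hw
    · rw [Function.update_of_ne (hne w hw), hs.bord w hw]
    · rw [List.mem_singleton.1 hw, Function.update_self, bord_append]
  · rcases (hdone w b).1 hd with hd | ⟨rfl, rfl⟩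
    · rw [Function.update_of_ne (hrow w b hd), hs.trans w b hd]
    · rw [Function.update_self, trans_of_isNode hn]
  · rw [hdone, not_or] at hd
    rw [Function.update_of_ne, hs.transNil b hd.1]
    intro he
    obtain ⟨hu0, hb⟩ := ht.row_inj (isNode_nil L) hun b.2.le a.2.le
      (show ν [] + (b : ℕ) = ν u + a by rw [ht.nil, Nat.zero_add, he])
    exact hd.2 ⟨hu0, Fin.ext hb⟩
  · rcases (hdone w b).1 hd with hd | ⟨rfl, rfl⟩
    · rw [Function.update_of_ne (hrow w b hd), hs.btrans w b hd]
    · rw [Function.update_self]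
  -- A write into the row of the root means `u = []`, and then the value written is `ν [] = 0`.
  · rw [Function.update_apply]
    split_ifs with he
    · obtain ⟨rfl, -⟩ := ht.row_inj (isNode_nil L) hun b.2.le a.2.le
        (show ν [] + (b : ℕ) = ν u + a by rw [ht.nil, Nat.zero_add, he])
      exact ht.nil
    · exact hs.btransNil b

theorem skip (hs : SearchArrays L ν q h a Q F B D A) (ht : Trie L T ν n G SZ PAR ST LN)
    (hq : Queue L q h a) (hu : q[h]? = some u) (hn : ¬ IsNode L (u ++ [a])) :
    SearchArrays L ν q h (a + 1) Q F B
      (Function.update D (ν u + a) (ν (HOG.fail L (u ++ [a]))))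
      (Function.update A (ν u + a) (ν (HOG.btrans u a))) := by
  have hun := hq.isNode u (List.mem_of_getElem? hu)
  have hdone : ∀ w b, Done q h (a + 1) w b ↔ Done q h a w b ∨ w = u ∧ b = a :=
    fun w b => done_succ hu
  have hrow : ∀ w b, Done q h a w b → ν w + b ≠ ν u + a := fun w b hd he => by
    obtain ⟨rfl, hb⟩ := ht.row_inj (hq.isNode w hd.mem) hun b.2.le a.2.le he
    exact hq.not_done hu (Fin.ext hb ▸ hd)
  refine ⟨hs.queue, hs.fail, hs.bord, fun w b hd => ?_, fun b hd => ?_,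
    fun w b hd => ?_, fun b => ?_⟩
  · rcases (hdone w b).1 hd with hd | ⟨rfl, rfl⟩
    · rw [Function.update_of_ne (hrow w b hd), hs.trans w b hd]
    · rw [Function.update_self, trans_eq_fail hn]
  · rw [hdone, not_or] at hd
    rw [Function.update_of_ne, hs.transNil b hd.1]
    intro he
    obtain ⟨hu0, hb⟩ := ht.row_inj (isNode_nil L) hun b.2.le a.2.le
      (show ν [] + (b : ℕ) = ν u + a by rw [ht.nil, Nat.zero_add, he])
    exact hd.2 ⟨hu0, Fin.ext hb⟩
  · rcases (hdone w b).1 hd with hd | ⟨rfl, rfl⟩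
    · rw [Function.update_of_ne (hrow w b hd), hs.btrans w b hd]
    · rw [Function.update_self]
  · rw [Function.update_apply]
    split_ifs with he
    · obtain ⟨rfl, -⟩ := ht.row_inj (isNode_nil L) hun b.2.le a.2.le
        (show ν [] + (b : ℕ) = ν u + a by rw [ht.nil, Nat.zero_add, he])
      exact ht.nil
    · exact hs.btransNil b

theorem next (hs : SearchArrays L ν q h σ Q F B D A) :
    SearchArrays L ν q (h + 1) 0 Q F B D A :=
  ⟨hs.queue, hs.fail, hs.bord, fun w a hd => hs.trans w a (done_next.1 hd),
    fun a hd => hs.transNil a (mt done_next.2 hd), fun w a hd => hs.btrans w a (done_next.1 hd),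
    hs.btransNil⟩

end SearchArrays

end Search

/-! ### The program for the breadth-first search -/

section SearchProgram

variable {σ : ℕ}

/-- The preparation for the next node of the breadth-first search. -/
def nodeStart : Prog := block
  -- Registers 18, 19 and 20 receive the node, its failure node and its border; 21 receives the
  -- letter following the border in the node, read from the text. The root has no such letter and
  -- gets `σ`, which no letter equals.
  [.load 18 13 16, .add 16 16 2, .load 19 14 18, .load 20 15 18,
    .ite (.eq 18 1) (.copy 21 4)
      (block [.load 21 9 18, .load 27 10 20, .add 21 21 27, .load 21 1 21]),
    .copy 22 1]

/-- The treatment of the next letter at a node of the breadth-first search. -/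
def childStep : Prog := block
  [.add 23 19 22, .load 25 16 23, .add 23 20 22, .ite (.eq 22 21) (.load 26 6 23) (.load 26 17 23),
    .add 23 18 22, .store 17 23 26, .load 24 6 23,
    .ite (.ne 24 1)
      (block [.store 14 24 25, .store 15 24 26, .store 16 23 24, .store 13 17 24, .add 17 17 2])
      (.store 16 23 25),
    .add 22 22 2]

/-- Breadth-first search of the trie. -/
def search : Prog := .while (.lt 16 17) (.seq nodeStart (.while (.lt 22 4) childStep))

/-- The memory stores the trie of `L`, with the numbers of the elements of `L` in array `11`. -/
structure TrieDone (L : List (List (Fin σ))) (ν : List (Fin σ) → ℕ) (n : ℕ) (s : State) :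
    Prop where
  trie : Trie L L.flatten ν n (s.arr 6) (s.arr 7) (s.arr 8) (s.arr 9) (s.arr 10)
  le : n ≤ L.flatten.length + 1
  ends : ∀ j (hj : j < L.length), s.arr 11 j = ν L[j]

theorem TrieDone.of_agrees {L : List (List (Fin σ))} {ν : List (Fin σ) → ℕ} {n : ℕ} {p : Prog}
    {s s' : State} (h : TrieDone L ν n s) (hA : Agrees p s s')
    (hp : ∀ a, 6 ≤ a → a < 12 → writesArr p a = false) : TrieDone L ν n s' := by
  refine ⟨?_, h.le, ?_⟩
  · simp only [hA.2 _ (hp 6 (by lia) (by lia)), hA.2 _ (hp 7 (by lia) (by lia)),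
      hA.2 _ (hp 8 (by lia) (by lia)), hA.2 _ (hp 9 (by lia) (by lia)),
      hA.2 _ (hp 10 (by lia) (by lia)), h.trie]
  · rw [hA.2 _ (hp 11 (by lia) (by lia))]
    exact h.ends

/-- The state of the memory when the node `u` at position `h` in the queue is treated. -/
structure AtNode (ν : List (Fin σ) → ℕ) (L : List (List (Fin σ))) (u : List (Fin σ))
    (h : ℕ) (s : State) : Prop where
  head : s.reg 16 = h + 1
  node : s.reg 18 = ν u
  fail : s.reg 19 = ν (fail L u)
  bord : s.reg 20 = ν (bord u)
  letter : ∀ a : Fin σ, (a : ℕ) = s.reg 21 ↔ u ≠ [] ∧ HOG.bord u ++ [a] <+: u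

/-- The progress of the breadth-first search. -/
structure Searching (L : List (List (Fin σ))) (ν : List (Fin σ) → ℕ)
    (q : List (List (Fin σ))) (h k : ℕ) (s : State) : Prop where
  queue : Queue L q h k
  arrays : SearchArrays L ν q h k (s.arr 13) (s.arr 14) (s.arr 15) (s.arr 16) (s.arr 17)
  tail : s.reg 17 = q.length

theorem nodeStart_runs {L : List (List (Fin σ))} {W : ℕ} (hW : WordBound L W) {s : State}
    (hc : Consts L s) {ν : List (Fin σ) → ℕ} {n : ℕ} (ht : TrieDone L ν n s)
    {q : List (List (Fin σ))} {h : ℕ} {u : List (Fin σ)} (hs : Searching L ν q h 0 s)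
    (h16 : s.reg 16 = h) (hu : q[h]? = some u) :
    Runs W nodeStart s (cost nodeStart)
      (fun s' => Searching L ν q h 0 s' ∧ AtNode ν L u h s' ∧ s'.reg 22 = 0) := by
  obtain ⟨hq, hs, h17⟩ := hs
  obtain ⟨ht, hn, -⟩ := ht
  obtain ⟨hh, hu'⟩ := List.getElem?_eq_some_iff.1 hu
  have huq : u ∈ q := List.mem_of_getElem? hu
  have hun := hq.isNode u huq
  have hlen := ht.length_le hq.nodup hq.isNode
  have hWlt := hW.lt
  have hbound : ∀ {w}, IsNode L w → ν w < W := fun hw => hW.mul_lt (by lia) (ht.lt hw).le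
  have hbn : IsNode L (bord u) := hun.of_prefix (bord_prefix u)
  refine Runs.of_wp nodeStart ?_
  simp only [nodeStart, block, wp, Test.Holds, State.reg_setReg, State.arr_setReg,
    State.reg_setArr, State.arr_setArr]
  simp [hc.reg1, hc.reg2, hc.reg4, h16, hs.queue h hh, hu', hs.fail u huq, hs.bord u huq,
    ht.eq_zero_iff hun, ht.len _ hbn]
  refine ⟨by lia, by lia, hbound hun, fun h0 => ⟨⟨hq, hs, ?_⟩, ?_⟩,
    fun h0 => ?_⟩
  · simp [State.reg_setReg, h17]
  · constructor <;> simp [State.reg_setReg, h0]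
    exact fun a => a.2.ne
  · obtain ⟨hT, hl⟩ := ht.letter hun (length_bord_lt h0)
    refine ⟨hbound hun, hbound hbn, by lia, ⟨hq, hs, ?_⟩, ?_⟩
    · simp [State.reg_setReg, h17]
    · constructor <;> simp [State.reg_setReg, h0]
      intro a
      rw [prefix_append_singleton_iff (bord_prefix u) (length_bord_lt h0), hc.letter hT, hl,
        eq_comm, Fin.ext_iff]

theorem childStep_runs {L : List (List (Fin σ))} {W : ℕ} (hW : WordBound L W) {s : State}
    (hc : Consts L s) {ν : List (Fin σ) → ℕ} {n : ℕ} (ht : TrieDone L ν n s)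
    {q : List (List (Fin σ))} {h : ℕ} {u : List (Fin σ)} {a : Fin σ}
    (hs : Searching L ν q h a s) (hn : AtNode ν L u h s) (hu : q[h]? = some u)
    (h22 : s.reg 22 = a) :
    Runs W childStep s (cost childStep) (fun s' => (∃ q', q'[h]? = some u ∧
      Searching L ν q' h (a + 1) s') ∧ s'.reg 22 = a + 1) := by
  obtain ⟨hq, hs, h17⟩ := hs
  obtain ⟨ht, hnL, -⟩ := ht
  obtain ⟨hh, hu'⟩ := List.getElem?_eq_some_iff.1 hu
  have huq : u ∈ q := List.mem_of_getElem? hu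
  have hun := hq.isNode u huq
  have hlen := ht.length_le hq.nodup hq.isNode
  have hWlt := hW.lt
  have hbn : IsNode L (bord u) := hun.of_prefix (bord_prefix u)
  have hbound : ∀ {w}, IsNode L w → ν w + a < W :=
    fun hw => hW.mul_lt (by lia) (ht.add_lt hw a a.2.le).le
  have hbound' : ∀ {w}, IsNode L w → ν w < W := fun hw => by
    have := hbound hw
    lia
  have hrow := hs.btransRow ht hq hu
  have hpush := hs.push ht hq hu
  have hskip := hs.skip ht hq hu
  have hmem := fun hv => hq.notMem hu hv
  have hqpush := hq.push hu
  have hqskip := hq.skip hu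
  have hchild := ht.child u a
  have hiff := ht.child_ne_zero_iff hun a
  have hcne := hn.letter a
  have haσ : (a : ℕ) + 1 < W := by
    have := hW.le
    have := a.2
    nlinarith
  refine Runs.of_wp childStep ?_
  simp only [childStep, block, wp, Test.Holds, State.reg_setReg, State.arr_setReg,
    State.reg_setArr, State.arr_setArr]
  simp [hc.reg1, hc.reg2, hc.reg4, hn.node, hn.fail, hn.bord, h22, hs.transRow ht hq hu, h17,
    hbound hun, hbound hbn, hbound (isNode_fail L u), haσ]
  refine ⟨fun hcase => ?_, fun hcase => ?_⟩
  · rw [if_pos (hcne.1 hcase)] at hrow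
    rw [hrow]
    refine ⟨fun h0 => ?_, fun h0 => ?_⟩
    · have hv := hiff.1 h0
      rw [hchild hv]
      refine ⟨hbound' hv, by lia, by lia, q ++ [u ++ [a]], ?_, hqpush hv, ?_, ?_⟩
      · rw [List.getElem?_append_left hh, hu]
      · simpa [State.arr_setReg, State.arr_setArr] using hpush hv
      · simp [State.reg_setReg]
    · have hv := fun hv => hiff.2 hv h0
      refine ⟨q, hu, hqskip hv, ?_, ?_⟩
      · simpa [State.arr_setReg, State.arr_setArr] using hskip hv
      · simp [State.reg_setReg, State.reg_setArr, h17]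
  · rw [if_neg (mt hcne.2 hcase)] at hrow
    rw [hrow]
    refine ⟨fun h0 => ?_, fun h0 => ?_⟩
    · have hv := hiff.1 h0
      rw [hchild hv]
      refine ⟨hbound' hv, by lia, by lia, q ++ [u ++ [a]], ?_, hqpush hv, ?_, ?_⟩
      · rw [List.getElem?_append_left hh, hu]
      · simpa [State.arr_setReg, State.arr_setArr] using hpush hv
      · simp [State.reg_setReg]
    · have hv := fun hv => hiff.2 hv h0
      refine ⟨q, hu, hqskip hv, ?_, ?_⟩
      · simpa [State.arr_setReg, State.arr_setArr] using hskip hv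
      · simp [State.reg_setReg, State.reg_setArr, h17]

theorem searchNode_runs {L : List (List (Fin σ))} {W : ℕ} (hW : WordBound L W) {s : State}
    (hc : Consts L s) {ν : List (Fin σ) → ℕ} {n : ℕ} (ht : TrieDone L ν n s)
    {q : List (List (Fin σ))} {h : ℕ} {u : List (Fin σ)} (hs : Searching L ν q h 0 s)
    (hn : AtNode ν L u h s) (hu : q[h]? = some u) (h22 : s.reg 22 = 0) :
    Runs W (.while (.lt 22 4) childStep) s (σ * (cost childStep + 1) + 1)
      (fun s' => ∃ q', Searching L ν q' (h + 1) 0 s') := by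
  refine (Runs.loop (W := W) (b := .lt 22 4) (s₀ := s) (p := childStep)
    (fun s => (∃ q', q'[h]? = some u ∧ Searching L ν q' h (s.reg 22) s) ∧ s.reg 22 ≤ σ)
    (fun s => (σ - s.reg 22) * (cost childStep + 1)) ?_
    ⟨⟨q, hu, by rwa [h22]⟩, by lia⟩).mono ?_ ?_
  · rintro s' hA ⟨⟨q', hu', hs'⟩, hle⟩ hb
    have hc' := hc.of_agrees hA (by decide) (by decide)
    simp only [Test.Holds, hc'.reg4] at hb
    have hn' : AtNode ν L u h s' := ⟨(hA.1 16 rfl).trans hn.head, (hA.1 18 rfl).trans hn.node,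
      (hA.1 19 rfl).trans hn.fail, (hA.1 20 rfl).trans hn.bord,
      fun a => by rw [hA.1 21 rfl, hn.letter a]⟩
    refine ⟨_, (childStep_runs hW hc' (ht.of_agrees hA (by decide)) (a := ⟨s'.reg 22, hb⟩) hs'
      hn' hu' rfl).mono le_rfl ?_⟩
    rintro s'' ⟨⟨q'', hu'', hs''⟩, h22''⟩
    simp only at h22''
    refine ⟨⟨⟨q'', hu'', by rwa [h22'']⟩, by lia⟩, ?_⟩
    rw [h22'', show σ - s'.reg 22 = σ - (s'.reg 22 + 1) + 1 by lia]
    lia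
  · simp [h22]
  · rintro s' ⟨⟨⟨q', hu', hs'⟩, hle⟩, hb, hA⟩
    simp only [Test.Holds, (hc.of_agrees hA (by decide) (by decide)).reg4] at hb
    rw [show s'.reg 22 = σ by lia] at hs'
    exact ⟨q', hs'.queue.next, hs'.arrays.next, hs'.tail⟩

theorem search_runs {L : List (List (Fin σ))} {W : ℕ} (hW : WordBound L W) {s : State}
    (hc : Consts L s) {ν : List (Fin σ) → ℕ} {n : ℕ} (ht : TrieDone L ν n s)
    (h16 : s.reg 16 = 0) (h17 : s.reg 17 = 1)
    (h : ∀ a, 13 ≤ a → a ≤ 17 → s.arr a = fun _ => 0) :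
    Runs W search s
      ((L.flatten.length + 1) * (cost nodeStart + (σ * (cost childStep + 1) + 1) + 1) + 1)
      (fun s' => ∃ q h, q.length ≤ h ∧ Searching L ν q h 0 s') := by
  refine (Runs.loop (W := W) (b := .lt 16 17) (s₀ := s)
    (p := .seq nodeStart (.while (.lt 22 4) childStep))
    (fun s => ∃ q, Searching L ν q (s.reg 16) 0 s)
    -- Register 16 is the head of the queue, and the queue never has more than `n` elements.
    (fun s => (n - s.reg 16) * (cost nodeStart + (σ * (cost childStep + 1) + 1) + 1)) ?_
    ⟨[[]], ?_, ?_, ?_⟩).mono ?_ ?_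
  · rintro s' hA ⟨q, hs⟩ hb
    have hc' := hc.of_agrees hA (by decide) (by decide)
    have ht' := ht.of_agrees hA (by decide)
    have hlen := ht'.trie.length_le hs.queue.nodup hs.queue.isNode
    simp only [Test.Holds, hs.tail] at hb
    have hu : q[s'.reg 16]? = some q[s'.reg 16] := List.getElem?_eq_getElem hb
    refine ⟨cost nodeStart + (σ * (cost childStep + 1) + 1),
      Runs.seq ((nodeStart_runs hW hc' ht' hs rfl hu).frame.mono le_rfl ?_)⟩
    rintro s₁ ⟨⟨hs₁, hn₁, h22⟩, hA₁⟩
    refine (searchNode_runs hW (hc'.of_agrees hA₁ (by decide) (by decide))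
      (ht'.of_agrees hA₁ (by decide)) hs₁ hn₁ hu h22).frame.mono le_rfl ?_
    rintro s₂ ⟨⟨q', hs₂⟩, hA₂⟩
    have h16' : s₂.reg 16 = s'.reg 16 + 1 := (hA₂.1 16 rfl).trans hn₁.head
    refine ⟨⟨q', by rwa [h16']⟩, ?_⟩
    rw [h16', show n - s'.reg 16 = n - (s'.reg 16 + 1) + 1 by lia]
    lia
  · rw [h16]
    exact Queue.start L
  · have hnil := ht.trie.nil
    rw [h16, h 13 (by lia) (by lia), h 14 (by lia) (by lia), h 15 (by lia) (by lia),
      h 16 (by lia) (by lia), h 17 (by lia) (by lia)]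
    constructor <;> simp [hnil, Done, fail_nil, bord_nil]
  · simp [h17]
  · rw [h16, Nat.sub_zero]
    exact Nat.add_le_add_right (Nat.mul_le_mul_right _ ht.le) 1
  · rintro s' ⟨⟨q, hs⟩, hb, -⟩
    simp only [Test.Holds, hs.tail] at hb
    exact ⟨q, _, by lia, hs⟩

end SearchProgram

section Marking

variable {σ : ℕ}

/-! ### Marking the vertices -/

/-- The result of the breadth-first search. -/
structure SearchDone (L : List (List (Fin σ))) (ν : List (Fin σ) → ℕ) (q : List (List (Fin σ)))
    (s : State) : Prop where
  mem_iff : ∀ w, w ∈ q ↔ IsNode L w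
  nodup : q.Nodup
  sorted : q.Pairwise fun v w => v.length ≤ w.length
  zero : q[0]? = some []
  queue : ∀ j (hj : j < q.length), s.arr 13 j = ν q[j]
  fail : ∀ w, IsNode L w → s.arr 14 (ν w) = ν (fail L w)
  bord : ∀ w, IsNode L w → s.arr 15 (ν w) = ν (bord w)
  tail : s.reg 17 = q.length

theorem Searching.done {L : List (List (Fin σ))} {ν : List (Fin σ) → ℕ}
    {q : List (List (Fin σ))} {h k : ℕ} {s : State} (hs : Searching L ν q h k s)
    (hh : q.length ≤ h) : SearchDone L ν q s :=
  ⟨fun _ => hs.queue.mem_iff hh, hs.queue.nodup, hs.queue.sorted, hs.queue.zero,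
    hs.arrays.queue, fun w hw => hs.arrays.fail w ((hs.queue.mem_iff hh).2 hw),
    fun w hw => hs.arrays.bord w ((hs.queue.mem_iff hh).2 hw), hs.tail⟩

theorem SearchDone.of_agrees {L : List (List (Fin σ))} {ν : List (Fin σ) → ℕ}
    {q : List (List (Fin σ))} {p : Prog} {s s' : State} (h : SearchDone L ν q s)
    (hA : Agrees p s s') (hp : ∀ a, 13 ≤ a → a < 16 → writesArr p a = false)
    (hr : writesReg p 17 = false) : SearchDone L ν q s' := by
  refine ⟨h.mem_iff, h.nodup, h.sorted, h.zero, ?_, ?_, ?_, (hA.1 17 hr).trans h.tail⟩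
  · rw [hA.2 _ (hp 13 (by lia) (by lia))]
    exact h.queue
  · rw [hA.2 _ (hp 14 (by lia) (by lia))]
    exact h.fail
  · rw [hA.2 _ (hp 15 (by lia) (by lia))]
    exact h.bord

/-- The start of the walk along the failure chain of the next string. -/
def chainStart : Prog := block [.load 29 11 28, .store 12 29 2, .load 29 14 29]

/-- One step of the walk along a failure chain. -/
def chainStep : Prog := block
  -- At the chain node `u` in register 29, the accumulated sum is compared with `size L u` and `u`
  -- is marked if the sum is smaller. Then its cell is cleared, `size L u` is added to the cell of
  -- `bord u`, and the walk moves to `fail L u`.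
  [.load 30 18 29, .load 31 7 29, .ite (.lt 30 31) (.store 12 29 2) .skip, .store 18 29 1,
    .load 30 15 29, .load 32 18 30, .add 32 32 31, .store 18 30 32, .load 29 14 29]

/-- The end of the walk along a failure chain. -/
def chainEnd : Prog := block [.store 18 1 1, .add 28 28 2]

/-- Marking of the vertices of the hierarchical overlap graph. -/
def markVertices : Prog :=
  .while (.lt 28 0) (.seq chainStart (.seq (.while (.ne 29 1) chainStep) chainEnd))

/-- The node `w` is one of the strings in `M` or a longest overlap from a string in `M` to a string
in `L`. -/
def Marked (L M : List (List (Fin σ))) (w : List (Fin σ)) : Prop :=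
  ∃ s ∈ M, w = s ∨ w <:+ s ∧ w ≠ s ∧ Covers L s w

/-- The state of the memory during the walk along the failure chain of `t`, at node `u`. -/
structure Walking (L : List (List (Fin σ))) (ν : List (Fin σ) → ℕ) (M : List (List (Fin σ)))
    (t u : List (Fin σ)) (s : State) : Prop where
  node : s.reg 29 = ν u
  isNode : IsNode L u
  suffix : u <:+ t
  ne : u = [] ∨ u ≠ t
  chain : ∃ X, IsChain L t u X ∧
    (∀ w, IsNode L w → s.arr 18 (ν w) =
      if w ∈ X then 0 else ∑ v ∈ X with HOG.bord v = w, HOG.size L v) ∧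
    ∀ w, IsNode L w → w ≠ [] →
      (s.arr 12 (ν w) = 1 ↔ Marked L M w ∨ w = t ∨ w ∈ X ∧ Covers L t w)

theorem chainStart_runs {L : List (List (Fin σ))} {W : ℕ} (hW : WordBound L W) {s : State}
    (hc : Consts L s) {ν : List (Fin σ) → ℕ} {n : ℕ} (ht : TrieDone L ν n s)
    {q : List (List (Fin σ))} (hs : SearchDone L ν q s) {i : ℕ} (hi : i < L.length)
    (h28 : s.reg 28 = i) (hacc : ∀ w, IsNode L w → s.arr 18 (ν w) = 0)
    (hmark : ∀ w, IsNode L w → w ≠ [] → (s.arr 12 (ν w) = 1 ↔ Marked L (L.take i) w)) :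
    Runs W chainStart s (cost chainStart) (Walking L ν (L.take i) L[i] (fail L L[i])) := by
  have hWlt := hW.lt
  have hle := hW.length_le
  have hln := ht.le
  have hn : IsNode L L[i] := .of_mem (List.getElem_mem hi)
  have hbound : ν L[i] < W := hW.mul_lt (by lia) (ht.trie.lt hn).le
  refine Runs.of_wp chainStart ?_
  simp only [chainStart, block, wp, Test.Holds, State.reg_setReg, State.arr_setReg,
    State.reg_setArr, State.arr_setArr]
  simp [hc.reg2, h28, ht.ends i hi, hs.fail _ hn, hbound]
  refine ⟨by lia, ?_, isNode_fail _ _, fail_suffix _ _, ?_, ∅, IsChain.nil, ?_, ?_⟩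
  · simp [State.reg_setReg]
  · by_cases h0 : L[i] = []
    · exact .inl (by rw [h0, fail_nil])
    · exact .inr fun he => by simpa [he] using length_fail_lt L h0
  · intro w hw
    simpa [State.arr_setReg, State.arr_setArr] using hacc w hw
  · intro w hw h0
    have h1 := hmark w hw h0
    have h2 : ν w = ν L[i] ↔ w = L[i] := ⟨ht.trie.inj _ _ hw hn, fun he => by rw [he]⟩
    by_cases hwi : w = L[i]
    · simp [State.arr_setReg, State.arr_setArr, hwi]
    · simp [State.arr_setReg, State.arr_setArr, Function.update_apply, h2, hwi, h1]

theorem chainStep_runs {L : List (List (Fin σ))} (hL : L.Nodup) {W : ℕ} (hW : WordBound L W)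
    {s : State} (hc : Consts L s) {ν : List (Fin σ) → ℕ} {n : ℕ} (ht : TrieDone L ν n s)
    {q : List (List (Fin σ))} (hs : SearchDone L ν q s) {M : List (List (Fin σ))}
    {t u : List (Fin σ)} (hw : Walking L ν M t u s) (hu : u ≠ []) :
    Runs W chainStep s (cost chainStep) (Walking L ν M t (fail L u)) := by
  obtain ⟨h29, hun, hut, hne, X, hX, hacc, hmark⟩ := hw
  have hne := hne.resolve_left hu
  have hX' := hX.insert hun hut hne hu
  have huX := hX.notMem
  have hWlt := hW.lt
  have hle := hW.length_le
  have hln := ht.le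
  obtain ⟨ht, -, -⟩ := ht
  have hbn : IsNode L (bord u) := hun.of_prefix (bord_prefix u)
  have hbu : bord u ≠ u := fun he => by simpa [he] using length_bord_lt hu
  -- The border is shorter than `u`, hence not yet visited, so its cell still holds a running sum.
  have hbX : bord u ∉ X := fun hb => ((hX _).1 hb).2.2.2.not_ge (length_bord_lt hu).le
  have hbν : ν (bord u) ≠ ν u := fun he => hbu (ht.inj _ _ hbn hun he)
  have hbound : ∀ {w}, IsNode L w → ν w < W := fun hw => hW.mul_lt (by lia) (ht.lt hw).le
  have haccu := hacc u hun
  rw [if_neg huX] at haccu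
  have haccb := hacc _ hbn
  rw [if_neg hbX] at haccb
  have hlt := hX.sum_lt_iff hL hut
  have hsum : ∀ w, ∑ v ∈ insert u X with bord v = w, size L v =
      (if bord u = w then size L u else 0) + ∑ v ∈ X with bord v = w, size L v := fun w => by
    rw [Finset.filter_insert]
    split_ifs with hb
    · rw [Finset.sum_insert (by simp [huX])]
    · rw [Nat.zero_add]
  have hsumle : ∑ v ∈ X with bord v = bord u, size L v + size L u < W := by
    have h1 := hX'.sum_le hL (bord u)
    have h2 := size_le_length L (bord u)
    rw [hsum, if_pos rfl] at h1
    lia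
  have hinj : ∀ {v w}, IsNode L v → IsNode L w → (ν v = ν w ↔ v = w) := fun hv hw =>
    ⟨ht.inj _ _ hv hw, fun he => by rw [he]⟩
  have hnew : ∀ w, IsNode L w → Function.update (Function.update (s.arr 18) (ν u) 0) (ν (bord u))
      (∑ v ∈ X with bord v = bord u, size L v + size L u) (ν w) =
      if w ∈ insert u X then 0 else ∑ v ∈ insert u X with bord v = w, size L v := by
    intro w hw
    simp only [hsum, Function.update_apply, hinj hw hbn, hinj hw hun, hacc w hw, Finset.mem_insert]
    by_cases hwb : w = bord u
    · subst hwb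
      simp [hbu, hbX, Nat.add_comm]
    · by_cases hwu : w = u
      · simp [hwu, hbu, hbu.symm]
      · simp [hwb, hwu, Ne.symm hwb]
  refine Runs.of_wp chainStep ?_
  simp only [chainStep, block, wp, Test.Holds, State.reg_setReg, State.arr_setReg,
    State.reg_setArr, State.arr_setArr]
  simp [hc.reg1, hc.reg2, h29, hs.fail _ hun, hs.bord _ hun, hbound hun, hbound hbn, haccu, haccb,
    ht.size _ hun, hbν, hsumle, Function.update_of_ne hbν]
  have hne' : fail L u = [] ∨ fail L u ≠ t := .inr fun he => by
    have h1 := length_fail_lt L hu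
    have h2 := hut.length_le
    rw [he] at h1
    lia
  refine ⟨fun h1 => ⟨?_, isNode_fail _ _, (fail_suffix _ _).trans hut, hne', _, hX', ?_, ?_⟩,
    fun h1 => ⟨?_, isNode_fail _ _, (fail_suffix _ _).trans hut, hne', _, hX', ?_, ?_⟩⟩
  · simp [State.reg_setReg]
  · intro w hw
    simpa [State.arr_setReg, State.arr_setArr] using hnew w hw
  · intro w hw h0
    have h2 := hmark w hw h0
    have h3 := hlt.1 h1
    by_cases hwu : w = u
    · subst hwu
      simp [State.arr_setReg, State.arr_setArr, h3]
    · simp [State.arr_setReg, State.arr_setArr, Function.update_apply, hinj hw hun, hwu, h2]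
  · simp [State.reg_setReg]
  · intro w hw
    simpa [State.arr_setReg, State.arr_setArr] using hnew w hw
  · intro w hw h0
    have h2 := hmark w hw h0
    have h3 := mt hlt.2 h1.not_gt
    by_cases hwu : w = u
    · subst hwu
      simp [State.arr_setReg, State.arr_setArr, h2, h3]
    · simp [State.arr_setReg, State.arr_setArr, hwu, h2]

/-- On reaching the root, only the root's cell can be nonzero, so clearing one cell readies the
accumulators for the next string. -/
theorem chainEnd_runs {L : List (List (Fin σ))} {W : ℕ} (hW : WordBound L W) {s : State}
    (hc : Consts L s) {ν : List (Fin σ) → ℕ} {n : ℕ} (ht : TrieDone L ν n s) {i : ℕ}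
    (hi : i < L.length) (h28 : s.reg 28 = i) (hw : Walking L ν (L.take i) L[i] [] s) :
    Runs W chainEnd s (cost chainEnd) (fun s' => (∀ w, IsNode L w → s'.arr 18 (ν w) = 0) ∧
      (∀ w, IsNode L w → w ≠ [] → (s'.arr 12 (ν w) = 1 ↔ Marked L (L.take (i + 1)) w)) ∧
      s'.reg 28 = i + 1) := by
  obtain ⟨-, -, -, -, X, hX, hacc, hmark⟩ := hw
  have hWlt := hW.lt
  have hle := hW.length_le
  have htake : L.take (i + 1) = L.take i ++ [L[i]] := by
    rw [List.take_add_one, List.getElem?_eq_getElem hi, Option.toList_some]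
  refine Runs.of_wp chainEnd ?_
  simp only [chainEnd, block, wp, Test.Holds, State.reg_setReg, State.arr_setReg,
    State.reg_setArr, State.arr_setArr]
  simp [hc.reg1, hc.reg2, h28]
  refine ⟨by lia, by lia, fun w hw => ?_, fun w hw h0 => ?_⟩
  · have hw0 := ht.trie.eq_zero_iff hw
    by_cases h0 : w = []
    · simp [hw0.2 h0]
    · rw [Function.update_of_ne (mt hw0.1 h0), hacc w hw]
      split_ifs with hwX
      · rfl
      -- A nonempty border of a chain node is itself on the chain, thus visited; a cell outside `X`
      -- has received nothing.
      · refine Finset.sum_eq_zero fun v hv => ?_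
        obtain ⟨hv, hb⟩ := Finset.mem_filter.1 hv
        obtain ⟨h1, h2, h3, h4⟩ := (hX v).1 hv
        refine (hwX ((hX w).2 ⟨hw, hb ▸ (bord_suffix v).trans h2, fun he => ?_,
          List.length_pos_iff.2 h0⟩)).elim
        have h5 := length_bord_lt (List.length_pos_iff.1 h4)
        have h6 := h2.length_le
        rw [hb, he] at h5
        lia
  · have h1 : w ∈ X ↔ w <:+ L[i] ∧ w ≠ L[i] :=
      ⟨fun h => ⟨((hX w).1 h).2.1, ((hX w).1 h).2.2.1⟩,
        fun h => (hX w).2 ⟨hw, h.1, h.2, List.length_pos_iff.2 h0⟩⟩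
    rw [hmark w hw h0, h1, htake]
    simp only [Marked, List.mem_append, List.mem_singleton, or_and_right, exists_or,
      exists_eq_left, and_assoc]

theorem walk_runs {L : List (List (Fin σ))} (hL : L.Nodup) {W : ℕ} (hW : WordBound L W)
    {s : State} (hc : Consts L s) {ν : List (Fin σ) → ℕ} {n : ℕ} (ht : TrieDone L ν n s)
    {q : List (List (Fin σ))} (hs : SearchDone L ν q s) {M : List (List (Fin σ))}
    {t u : List (Fin σ)} (hw : Walking L ν M t u s) :
    Runs W (.while (.ne 29 1) chainStep) s (t.length * (cost chainStep + 1) + 1)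
      (Walking L ν M t []) := by
  refine (Runs.loop (W := W) (b := .ne 29 1) (s₀ := s) (p := chainStep)
    (fun s => ∃ u, Walking L ν M t u s)
    -- Array 10 holds the length of the current node, which each failure link decreases.
    (fun s => s.arr 10 (s.reg 29) * (cost chainStep + 1)) ?_ ⟨u, hw⟩).mono ?_ ?_
  · rintro s' hA ⟨u, hw⟩ hb
    have hc' := hc.of_agrees hA (by decide) (by decide)
    have ht' := ht.of_agrees hA (by decide)
    simp only [Test.Holds, hc'.reg1, hw.node] at hb
    have hu := mt (ht'.trie.eq_zero_iff hw.isNode).2 hb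
    refine ⟨_, (chainStep_runs hL hW hc' ht' (hs.of_agrees hA (by decide) rfl) hw
      hu).frame.mono le_rfl ?_⟩
    rintro s'' ⟨hw', hA'⟩
    refine ⟨⟨_, hw'⟩, ?_⟩
    rw [hw.node, hw'.node, hA'.2 10 rfl, ht'.trie.len _ hw.isNode, ht'.trie.len _ hw'.isNode]
    have := Nat.mul_le_mul_right (cost chainStep + 1) (length_fail_lt L hu)
    rw [Nat.succ_mul] at this
    lia
  · rw [hw.node, ht.trie.len _ hw.isNode]
    exact Nat.add_le_add_right (Nat.mul_le_mul_right _ hw.suffix.length_le) 1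
  · rintro s' ⟨⟨u, hw⟩, hb, hA⟩
    simp only [Test.Holds, (hc.of_agrees hA (by decide) (by decide)).reg1, hw.node, ne_eq,
      not_not] at hb
    rwa [(ht.trie.eq_zero_iff hw.isNode).1 hb] at hw

theorem markVertices_runs {L : List (List (Fin σ))} (hL : L.Nodup) {W : ℕ} (hW : WordBound L W)
    {s : State} (hc : Consts L s) {ν : List (Fin σ) → ℕ} {n : ℕ} (ht : TrieDone L ν n s)
    {q : List (List (Fin σ))} (hs : SearchDone L ν q s) (h28 : s.reg 28 = 0)
    (h12 : s.arr 12 = fun _ => 0) (h18 : s.arr 18 = fun _ => 0) :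
    Runs W markVertices s (L.flatten.length * (cost chainStep + 1) +
        L.length * (cost chainStart + cost chainEnd + 2) + 1)
      (fun s' => ∀ w, IsNode L w → w ≠ [] → (s'.arr 12 (ν w) = 1 ↔ Marked L L w)) := by
  refine (Runs.loop (W := W) (b := .lt 28 0) (s₀ := s)
    (p := .seq chainStart (.seq (.while (.ne 29 1) chainStep) chainEnd))
    (fun s => s.reg 28 ≤ L.length ∧ (∀ w, IsNode L w → s.arr 18 (ν w) = 0) ∧
      ∀ w, IsNode L w → w ≠ [] → (s.arr 12 (ν w) = 1 ↔ Marked L (L.take (s.reg 28)) w))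
    (fun s => (L.flatten.length - pos L (s.reg 28)) * (cost chainStep + 1) +
        (L.length - s.reg 28) * (cost chainStart + cost chainEnd + 2)) ?_ ?_).mono ?_ ?_
  · rintro s' hA ⟨hle, hacc, hmark⟩ hb
    have hc' := hc.of_agrees hA (by decide) (by decide)
    have ht' := ht.of_agrees hA (by decide)
    have hs' := hs.of_agrees hA (by decide) rfl
    simp only [Test.Holds, hc'.reg0] at hb
    refine ⟨cost chainStart + (L[s'.reg 28].length * (cost chainStep + 1) + 1 + cost chainEnd),
      Runs.seq ((chainStart_runs hW hc' ht' hs' hb rfl hacc hmark).frame.mono le_rfl ?_)⟩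
    rintro s₁ ⟨hw₁, hA₁⟩
    have hc₁ := hc'.of_agrees hA₁ (by decide) (by decide)
    have ht₁ := ht'.of_agrees hA₁ (by decide)
    refine Runs.seq ((walk_runs hL hW hc₁ ht₁ (hs'.of_agrees hA₁ (by decide) rfl)
      hw₁).frame.mono le_rfl ?_)
    rintro s₂ ⟨hw₂, hA₂⟩
    refine (chainEnd_runs hW (hc₁.of_agrees hA₂ (by decide) (by decide))
      (ht₁.of_agrees hA₂ (by decide)) hb ((hA₂.1 28 rfl).trans (hA₁.1 28 rfl)) hw₂).mono le_rfl ?_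
    rintro s₃ ⟨h₁, h₂, h₃⟩
    refine ⟨⟨by lia, h₁, by rwa [h₃]⟩, ?_⟩
    have hp := pos_add_le hb
    rw [h₃, pos_succ hb, show L.length - s'.reg 28 = L.length - (s'.reg 28 + 1) + 1 by lia,
      show L.flatten.length - pos L (s'.reg 28) = L.flatten.length -
        (pos L (s'.reg 28) + L[s'.reg 28].length) + L[s'.reg 28].length by lia]
    lia
  · simp [h28, h12, h18, Marked]
  · simp [h28, pos]
  · rintro s' ⟨⟨hle, hacc, hmark⟩, hb, hA⟩
    simp only [Test.Holds, (hc.of_agrees hA (by decide) (by decide)).reg0] at hb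
    rwa [show s'.reg 28 = L.length by lia, List.take_length] at hmark

theorem marked_iff {L : List (List (Fin σ))} {w : List (Fin σ)} (h0 : w ≠ []) :
    Marked L L w ↔ w ∈ vertices {x | x ∈ L} := by
  rw [mem_vertices_iff]
  simp only [Marked, h0, false_or]
  grind

end Marking

section Output

variable {σ : ℕ}

/-! ### Writing the output -/

/-- The first `j` nodes in the queue `q` have been treated, and the vertices among them are stored
in the arrays `P2`, `P3`, `P4`, `P5` in the order of the list `E`; the arrays `PU` and `PF` hold the
numbers of the longest prefix and the longest suffix of every treated node that are vertices. -/
structure OutputArrays (L : List (List (Fin σ))) (ν : List (Fin σ) → ℕ)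
    (q : List (List (Fin σ))) (j : ℕ) (E : List (List (Fin σ))) (P2 P3 P4 P5 PU PF : ℕ → ℕ) :
    Prop where
  root : E[0]? = some []
  nodup : E.Nodup
  mem_iff : ∀ w, w ∈ E ↔ w ∈ q.take j ∧ w ∈ vertices {x | x ∈ L}
  start : ∀ e y, E[e]? = some y → (L.flatten.drop (P2 e)).take (P3 e) = y
  len : ∀ e y, E[e]? = some y → P3 e = y.length
  tree : ∀ e y, E[e]? = some y → e ≠ 0 → ∃ x, E[P4 e]? = some x ∧
    IsLongest (fun z => z ∈ vertices {x | x ∈ L} ∧ IsProperPrefix z y) x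
  link : ∀ e y, E[e]? = some y → e ≠ 0 → ∃ x, E[P5 e]? = some x ∧
    IsLongest (fun z => z ∈ vertices {x | x ∈ L} ∧ IsProperSuffix z y) x
  up : ∀ w ∈ q.take j, ∃ x, E[PU (ν w)]? = some x ∧
    IsLongest (fun z => z ∈ vertices {x | x ∈ L} ∧ z <+: w) x
  back : ∀ w ∈ q.take j, ∃ x, E[PF (ν w)]? = some x ∧
    IsLongest (fun z => z ∈ vertices {x | x ∈ L} ∧ z <:+ w) x

theorem properPrefix_concat_iff {p z : List (Fin σ)} {a : Fin σ} :
    IsProperPrefix z (p ++ [a]) ↔ z <+: p := by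
  rw [IsProperPrefix, List.prefix_concat_iff]
  refine ⟨fun h => h.1.resolve_left h.2, fun h => ⟨.inr h, ?_⟩⟩
  rintro rfl
  simpa using h.length_le

/-- All vertices are nodes, and `fail L w` is the longest node that is a proper suffix of `w`. -/
theorem properSuffix_iff_of_vertex {L : List (List (Fin σ))} {w z : List (Fin σ)} (hw : w ≠ [])
    (hz : z ∈ vertices {x | x ∈ L}) : IsProperSuffix z w ↔ z <:+ fail L w := by
  refine ⟨fun h => suffix_fail (isNode_of_mem_vertices hz) h.1 h.2,
    fun h => ⟨h.trans (fail_suffix L w), ?_⟩⟩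
  rintro rfl
  have h1 := h.length_le
  have h2 := length_fail_lt L hw
  lia

theorem IsLongest.congr {α : Type*} {Q Q' : List α → Prop} {x : List α} (h : IsLongest Q x)
    (hQ : ∀ z, Q z ↔ Q' z) : IsLongest Q' x :=
  ⟨(hQ x).1 h.1, fun z hz => h.2 z ((hQ z).2 hz)⟩

theorem getElem?_concat_iff {α : Type*} {E : List α} {w y : α} {e : ℕ} :
    (E ++ [w])[e]? = some y ↔ E[e]? = some y ∨ e = E.length ∧ y = w := by
  rcases lt_trichotomy e E.length with h | h | h
  · rw [List.getElem?_append_left h]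
    simp [h.ne]
  · subst h
    simp [eq_comm]
  · rw [List.getElem?_eq_none (by simp; lia), List.getElem?_eq_none h.le]
    simp [h.ne']

/-! ### Growth of the vertex list and correctness of the stored graph -/

namespace OutputArrays

variable {L q E : List (List (Fin σ))} {ν : List (Fin σ) → ℕ} {j : ℕ}
  {P2 P3 P4 P5 PU PF : ℕ → ℕ} {p w : List (Fin σ)} {a : Fin σ}

theorem parent (h : OutputArrays L ν q j E P2 P3 P4 P5 PU PF) (hp : p ∈ q.take j) (a : Fin σ) :
    ∃ x, E[PU (ν p)]? = some x ∧
      IsLongest (fun z => z ∈ vertices {x | x ∈ L} ∧ IsProperPrefix z (p ++ [a])) x := by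
  obtain ⟨x, hx, hl⟩ := h.up p hp
  exact ⟨x, hx, hl.congr fun z => by rw [properPrefix_concat_iff]⟩

theorem target (h : OutputArrays L ν q j E P2 P3 P4 P5 PU PF) (hw : w ≠ [])
    (hf : fail L w ∈ q.take j) : ∃ x, E[PF (ν (fail L w))]? = some x ∧
      IsLongest (fun z => z ∈ vertices {x | x ∈ L} ∧ IsProperSuffix z w) x := by
  obtain ⟨x, hx, hl⟩ := h.back _ hf
  exact ⟨x, hx, hl.congr fun z => and_congr_right fun hz =>
    (properSuffix_iff_of_vertex hw hz).symm⟩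

theorem take_succ (hj : q[j]? = some w) {v : List (Fin σ)} :
    v ∈ q.take (j + 1) ↔ v ∈ q.take j ∨ v = w := by
  rw [List.take_add_one, hj, Option.toList_some, List.mem_append, List.mem_singleton]

theorem emit (h : OutputArrays L ν q j E P2 P3 P4 P5 PU PF) (hj : q[j]? = some w)
    (hwj : w ∉ q.take j) (hν : ∀ v ∈ q.take j, ν v ≠ ν w) (hwV : w ∈ vertices {x | x ∈ L})
    {st e₁ e₂ : ℕ} (hst : (L.flatten.drop st).take w.length = w)
    (h₁ : ∃ x, E[e₁]? = some x ∧
      IsLongest (fun z => z ∈ vertices {x | x ∈ L} ∧ IsProperPrefix z w) x)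
    (h₂ : ∃ x, E[e₂]? = some x ∧
      IsLongest (fun z => z ∈ vertices {x | x ∈ L} ∧ IsProperSuffix z w) x) :
    OutputArrays L ν q (j + 1) (E ++ [w]) (Function.update P2 E.length st)
      (Function.update P3 E.length w.length) (Function.update P4 E.length e₁)
      (Function.update P5 E.length e₂) (Function.update PU (ν w) E.length)
      (Function.update PF (ν w) E.length) := by
  have hlt : ∀ {e y}, E[e]? = some y → e ≠ E.length := fun he =>
    (List.getElem?_eq_some_iff.1 he).1.ne
  have happ : ∀ {e y}, E[e]? = some y → (E ++ [w])[e]? = some y := fun he =>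
    getElem?_concat_iff.2 (.inl he)
  refine ⟨happ h.root, h.nodup.append (List.nodup_singleton _) ?_, fun v => ?_, fun e y he => ?_,
    fun e y he => ?_, fun e y he h0 => ?_, fun e y he h0 => ?_, fun v hv => ?_, fun v hv => ?_⟩
  · simpa [h.mem_iff] using fun h' => (hwj h').elim
  · rw [List.mem_append, h.mem_iff, List.mem_singleton, take_succ hj]
    grind
  · rcases getElem?_concat_iff.1 he with he | ⟨rfl, rfl⟩
    · rw [Function.update_of_ne (hlt he), Function.update_of_ne (hlt he), h.start e y he]
    · rwa [Function.update_self, Function.update_self]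
  · rcases getElem?_concat_iff.1 he with he | ⟨rfl, rfl⟩
    · rw [Function.update_of_ne (hlt he), h.len e y he]
    · rw [Function.update_self]
  · rcases getElem?_concat_iff.1 he with he | ⟨rfl, rfl⟩
    · obtain ⟨x, hx, hl⟩ := h.tree e y he h0
      exact ⟨x, by rw [Function.update_of_ne (hlt he), happ hx], hl⟩
    · obtain ⟨x, hx, hl⟩ := h₁
      exact ⟨x, by rw [Function.update_self, happ hx], hl⟩
  · rcases getElem?_concat_iff.1 he with he | ⟨rfl, rfl⟩
    · obtain ⟨x, hx, hl⟩ := h.link e y he h0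
      exact ⟨x, by rw [Function.update_of_ne (hlt he), happ hx], hl⟩
    · obtain ⟨x, hx, hl⟩ := h₂
      exact ⟨x, by rw [Function.update_self, happ hx], hl⟩
  · rcases (take_succ hj).1 hv with hv | rfl
    · obtain ⟨x, hx, hl⟩ := h.up v hv
      exact ⟨x, by rw [Function.update_of_ne (hν v hv), happ hx], hl⟩
    · exact ⟨v, by simp, ⟨hwV, List.prefix_rfl⟩, fun z hz => hz.2.length_le⟩
  · rcases (take_succ hj).1 hv with hv | rfl
    · obtain ⟨x, hx, hl⟩ := h.back v hv
      exact ⟨x, by rw [Function.update_of_ne (hν v hv), happ hx], hl⟩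
    · exact ⟨v, by simp, ⟨hwV, List.suffix_rfl⟩, fun z hz => hz.2.length_le⟩

/-- As `w` is no vertex, the vertices that are prefixes or suffixes of `w` are proper ones, so the
inherited entries are right for `w` too. -/
theorem pass (h : OutputArrays L ν q j E P2 P3 P4 P5 PU PF) (hj : q[j]? = some w)
    (hν : ∀ v ∈ q.take j, ν v ≠ ν w) (hwV : w ∉ vertices {x | x ∈ L}) {e₁ e₂ : ℕ}
    (h₁ : ∃ x, E[e₁]? = some x ∧
      IsLongest (fun z => z ∈ vertices {x | x ∈ L} ∧ IsProperPrefix z w) x)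
    (h₂ : ∃ x, E[e₂]? = some x ∧
      IsLongest (fun z => z ∈ vertices {x | x ∈ L} ∧ IsProperSuffix z w) x) :
    OutputArrays L ν q (j + 1) E P2 P3 P4 P5 (Function.update PU (ν w) e₁)
      (Function.update PF (ν w) e₂) := by
  have hne : ∀ {z}, z ∈ vertices {x | x ∈ L} → z ≠ w := fun hz he => hwV (he ▸ hz)
  refine ⟨h.root, h.nodup, fun v => ?_, h.start, h.len, h.tree, h.link, fun v hv => ?_,
    fun v hv => ?_⟩
  · rw [h.mem_iff, take_succ hj]
    grind
  · rcases (take_succ hj).1 hv with hv | rfl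
    · rw [Function.update_of_ne (hν v hv)]
      exact h.up v hv
    · rw [Function.update_self]
      obtain ⟨x, hx, hl⟩ := h₁
      exact ⟨x, hx, hl.congr fun z => and_congr_right fun hz => and_iff_left (hne hz)⟩
  · rcases (take_succ hj).1 hv with hv | rfl
    · rw [Function.update_of_ne (hν v hv)]
      exact h.back v hv
    · rw [Function.update_self]
      obtain ⟨x, hx, hl⟩ := h₂
      exact ⟨x, hx, hl.congr fun z => and_congr_right fun hz => and_iff_left (hne hz)⟩

/-- Two longest vertices that are prefixes (or suffixes) of one string coincide, so storing one
endpoint per vertex determines the edges in both directions. -/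
theorem storesHog {s : State}
    (h : OutputArrays L ν q j E (s.arr 2) (s.arr 3) (s.arr 4) (s.arr 5) PU PF)
    (htext : s.arr 1 = (inputState L).arr 1) (h0 : s.reg 0 = E.length)
    (hq : ∀ w, IsNode L w → w ∈ q.take j) : StoresHog L s := by
  have hmem : ∀ w, w ∈ E ↔ w ∈ vertices {x | x ∈ L} := fun w =>
    (h.mem_iff w).trans (and_iff_right_of_imp fun hw => hq w (isNode_of_mem_vertices hw))
  have hget : ∀ v, v < s.reg 0 → E[v]? = some (outputString L s v) := fun v hv => by
    rw [h0] at hv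
    rw [outputString, h.start v E[v] (List.getElem?_eq_getElem hv), List.getElem?_eq_getElem hv]
  have hlt : ∀ {v y}, E[v]? = some y → v < s.reg 0 := fun hv =>
    h0 ▸ (List.getElem?_eq_some_iff.1 hv).1
  have hstr : ∀ {v y}, E[v]? = some y → outputString L s v = y := fun hv =>
    Option.some.inj ((hget _ (hlt hv)).symm.trans hv)
  have hV : ∀ v, v < s.reg 0 → outputString L s v ∈ vertices {x | x ∈ L} := fun v hv =>
    (hmem _).1 (List.mem_of_getElem? (hget v hv))
  have hinj : ∀ {u v y}, E[u]? = some y → E[v]? = some y → u = v := fun hu hv =>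
    (List.getElem?_inj (List.getElem?_eq_some_iff.1 hu).1 h.nodup).1 (hu.trans hv.symm)
  have hroot : ∀ v, v < s.reg 0 → outputString L s v ≠ [] → v ≠ 0 := by
    rintro v hv hne rfl
    exact hne (hstr h.root)
  refine ⟨htext, fun v hv => (h.len v _ (hget v hv)).symm, ⟨?_, ?_, ⟨hV, ?_, ?_⟩, ?_, ?_⟩⟩
  · rintro ⟨u, v⟩ ⟨hv0, hv, he⟩
    change u = s.arr 4 v at he
    subst he
    obtain ⟨x, hx, -⟩ := h.tree v _ (hget v hv) hv0
    exact ⟨hlt hx, hv⟩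
  · rintro ⟨u, v⟩ ⟨hu0, hu, he⟩
    change v = s.arr 5 u at he
    subst he
    obtain ⟨x, hx, -⟩ := h.link u _ (hget u hu) hu0
    exact ⟨hu, hlt hx⟩
  · intro u hu v hv he
    exact hinj (hget u hu) (he ▸ hget v hv)
  · intro w hw
    obtain ⟨v, hv, rfl⟩ := List.getElem_of_mem ((hmem w).2 hw)
    exact ⟨v, hlt (List.getElem?_eq_getElem hv), hstr (List.getElem?_eq_getElem hv)⟩
  · intro u hu v hv
    constructor
    · rintro ⟨hv0, -, he⟩
      change u = s.arr 4 v at he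
      subst he
      obtain ⟨x, hx, hl⟩ := h.tree v _ (hget v hv) hv0
      exact ⟨hV _ hu, hV _ hv, by rwa [hstr hx]⟩
    · rintro ⟨-, -, hl⟩
      -- Number `0` is the empty string, which has no proper prefix.
      have hv0 : v ≠ 0 := hroot v hv fun he =>
        hl.1.2.2 ((List.prefix_nil.1 (he ▸ hl.1.2.1)).trans he.symm)
      obtain ⟨x, hx, hl'⟩ := h.tree v _ (hget v hv) hv0
      refine ⟨hv0, hv, hinj (hget u hu) ?_⟩
      rw [hx, List.prefix_of_prefix_length_le hl'.1.2.1 hl.1.2.1 (hl.2 _ hl'.1)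
        |>.eq_of_length_le (hl'.2 _ hl.1)]
  · intro u hu v hv
    constructor
    · rintro ⟨hu0, -, he⟩
      change v = s.arr 5 u at he
      subst he
      obtain ⟨x, hx, hl⟩ := h.link u _ (hget u hu) hu0
      exact ⟨hV _ hu, hV _ hv, by rwa [hstr hx]⟩
    · rintro ⟨-, -, hl⟩
      have hu0 : u ≠ 0 := hroot u hu fun he =>
        hl.1.2.2 ((List.suffix_nil.1 (he ▸ hl.1.2.1)).trans he.symm)
      obtain ⟨x, hx, hl'⟩ := h.link u _ (hget u hu) hu0
      refine ⟨hu0, hu, hinj (hget v hv) ?_⟩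
      rw [hx, (suffix_of_suffix_of_length_le hl'.1.2.1 hl.1.2.1 (hl.2 _ hl'.1)).eq_of_length_le
        (hl'.2 _ hl.1)]

end OutputArrays

/-- The number of the root is output. -/
def outputStart : Prog := block [.copy 0 2, .copy 33 2]

/-- The treatment of the next node in the output phase. -/
def outputStep : Prog := block
  -- Registers 35 and 36 receive the entry of the parent in array 19 and that of the failure node in
  -- array 20: the source of the tree edge and the target of the failure link. An emitted vertex
  -- replaces both by its own number before they are stored for its descendants.
  [.load 34 13 33, .load 35 8 34, .load 35 19 35, .load 36 14 34, .load 36 20 36, .load 37 12 34,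
    .ite (.eq 37 2)
      (block [.load 37 9 34, .store 2 0 37, .load 37 10 34, .store 3 0 37, .store 4 0 35,
        .store 5 0 36, .copy 35 0, .copy 36 0, .add 0 0 2]) .skip,
    .store 19 34 35, .store 20 34 36, .add 33 33 2]

/-- The output of the hierarchical overlap graph. -/
def output : Prog := .seq outputStart (.while (.lt 33 17) outputStep)

/-- The state of the memory in the output phase. -/
def Outputting (L : List (List (Fin σ))) (ν : List (Fin σ) → ℕ) (q : List (List (Fin σ)))
    (j : ℕ) (s : State) : Prop :=
  ∃ E, OutputArrays L ν q j E (s.arr 2) (s.arr 3) (s.arr 4) (s.arr 5) (s.arr 19) (s.arr 20) ∧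
    s.reg 0 = E.length

theorem SearchDone.mem_take {L : List (List (Fin σ))} {ν : List (Fin σ) → ℕ}
    {q : List (List (Fin σ))} {s : State} (hs : SearchDone L ν q s) {j : ℕ} {w v : List (Fin σ)}
    (hj : q[j]? = some w) (hv : IsNode L v) (hlt : v.length < w.length) : v ∈ q.take j := by
  obtain ⟨hjq, rfl⟩ := List.getElem?_eq_some_iff.1 hj
  obtain ⟨i, hi, rfl⟩ := List.getElem_of_mem ((hs.mem_iff v).2 hv)
  refine List.mem_take_iff_getElem.2 ⟨i, ?_, rfl⟩
  by_contra! hle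
  rcases (show j ≤ i by lia).lt_or_eq with hlt' | rfl
  · have := List.pairwise_iff_getElem.1 hs.sorted j i hjq hi hlt'
    lia
  · exact lt_irrefl _ hlt

/-- Only register 2 is required to be intact: register 0 now counts the vertices, so `Consts` no
longer holds. -/
theorem outputStep_runs {L : List (List (Fin σ))} {W : ℕ} (hW : WordBound L W) {s : State}
    (h2 : s.reg 2 = 1) {ν : List (Fin σ) → ℕ} {n : ℕ} (ht : TrieDone L ν n s)
    {q : List (List (Fin σ))} (hs : SearchDone L ν q s)
    (hmark : ∀ w, IsNode L w → w ≠ [] → (s.arr 12 (ν w) = 1 ↔ w ∈ vertices {x | x ∈ L}))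
    {j : ℕ} (h33 : s.reg 33 = j) (hj0 : j ≠ 0) (hj : j < q.length)
    (ho : Outputting L ν q j s) :
    Runs W outputStep s (cost outputStep)
      (fun s' => Outputting L ν q (j + 1) s' ∧ s'.reg 33 = j + 1) := by
  obtain ⟨E, ho, h0⟩ := ho
  obtain ⟨ht, hln, -⟩ := ht
  have hjw : q[j]? = some q[j] := List.getElem?_eq_getElem hj
  have hqj := hs.queue j hj
  generalize q[j] = w at hjw hqj
  have hwn : IsNode L w := (hs.mem_iff w).1 (List.mem_of_getElem? hjw)
  have hwj : w ∉ q.take j := fun hw => by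
    obtain ⟨i, hi, hi'⟩ := List.mem_take_iff_getElem.1 hw
    have h1 := (List.getElem?_inj (by lia) hs.nodup).1
      ((List.getElem?_eq_some_iff.2 ⟨by lia, hi'⟩).trans hjw.symm)
    lia
  have hne : w ≠ [] := by
    rintro rfl
    exact hj0 ((List.getElem?_inj hj hs.nodup).1 (hjw.trans hs.zero.symm))
  have hν : ∀ v ∈ q.take j, ν v ≠ ν w := fun v hv he =>
    hwj (ht.inj v w ((hs.mem_iff v).1 (List.mem_of_mem_take hv)) hwn he ▸ hv)
  have hWlt := hW.lt
  have hqlen := ht.length_le hs.nodup fun w hw => (hs.mem_iff w).1 hw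
  have hElen := ht.length_le ho.nodup fun w hw =>
    isNode_of_mem_vertices ((ho.mem_iff w).1 hw).2
  have hbound : ∀ {w}, IsNode L w → ν w < W := fun hw => hW.mul_lt (by lia) (ht.lt hw).le
  have h₂ := ho.target hne (hs.mem_take hjw (isNode_fail L w) (length_fail_lt L hne))
  have hfail := hs.fail w hwn
  have hst := ht.start w hwn
  have hlen := ht.len w hwn
  have hmark := hmark w hwn hne
  obtain ⟨p, hpn, hpar, h₁⟩ : ∃ p, IsNode L p ∧ s.arr 8 (ν w) = ν p ∧
      ∃ x, E[s.arr 19 (ν p)]? = some x ∧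
        IsLongest (fun z => z ∈ vertices {x | x ∈ L} ∧ IsProperPrefix z w) x := by
    obtain ⟨p, a, rfl⟩ : ∃ p a, w = p ++ [a] := ⟨_, _, (List.dropLast_concat_getLast hne).symm⟩
    exact ⟨p, hwn.of_append, ht.parent p a hwn,
      ho.parent (hs.mem_take hjw hwn.of_append (by simp)) a⟩
  refine Runs.of_wp outputStep ?_
  simp only [outputStep, block, wp, Test.Holds, State.reg_setReg, State.arr_setReg,
    State.reg_setArr, State.arr_setArr]
  simp [h2, h33, hqj, hfail, hpar, hlen, hbound hwn, hbound hpn, hbound (isNode_fail L w), h0,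
    hmark]
  refine ⟨by lia, fun hV => ⟨by lia, by lia, by lia, E ++ [w], ?_, ?_⟩,
    fun hV => ⟨by lia, E, ?_, ?_⟩⟩
  · simpa [State.arr_setReg, State.arr_setArr, hlen] using ho.emit hjw hwj hν hV hst h₁ h₂
  · simp [State.reg_setReg, State.reg_setArr]
  · simpa [State.arr_setReg, State.arr_setArr] using ho.pass hjw hν hV h₁ h₂
  · simp [State.reg_setReg, State.reg_setArr, h0]

/-- The record of the root is never written: its length and its entries in arrays 19 and 20 are the
zeros of the initial memory. -/
theorem output_runs {L : List (List (Fin σ))} {W : ℕ} (hW : WordBound L W) {s : State}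
    (hc : Consts L s) {ν : List (Fin σ) → ℕ} {n : ℕ} (ht : TrieDone L ν n s)
    {q : List (List (Fin σ))} (hs : SearchDone L ν q s)
    (hmark : ∀ w, IsNode L w → w ≠ [] → (s.arr 12 (ν w) = 1 ↔ w ∈ vertices {x | x ∈ L}))
    (h3 : s.arr 3 = fun _ => 0) (h19 : s.arr 19 = fun _ => 0) (h20 : s.arr 20 = fun _ => 0) :
    Runs W output s (cost outputStart + ((L.flatten.length + 1) * (cost outputStep + 1) + 1))
      (StoresHog L) := by
  have hqlen := ht.trie.length_le hs.nodup fun w hw => (hs.mem_iff w).1 hw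
  obtain ⟨hq0, hq0'⟩ := List.getElem?_eq_some_iff.1 hs.zero
  have htake1 : ∀ w, w ∈ q.take 1 ↔ w = [] := fun w => by
    rw [show (1 : ℕ) = 0 + 1 by rfl, OutputArrays.take_succ hs.zero]
    simp
  refine Runs.seq (Q := StoresHog L) ?_
  have hstart : Runs W outputStart s (cost outputStart)
      (fun s' => Outputting L ν q (s'.reg 33) s' ∧ s'.reg 33 = 1) := by
    refine Runs.of_wp outputStart ?_
    simp only [outputStart, block, wp, Test.Holds, State.reg_setReg, State.arr_setReg,
      State.reg_setArr, State.arr_setArr]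
    simp [hc.reg2]
    refine ⟨[[]], ⟨rfl, by simp, fun w => ?_, ?_, ?_, ?_, ?_, fun w hw => ?_, fun w hw => ?_⟩, ?_⟩
    · rw [htake1, List.mem_singleton, iff_self_and]
      rintro rfl
      exact mem_vertices_iff.2 (.inl rfl)
    · simp +contextual [State.arr_setReg, h3, List.getElem?_singleton]
    · simp +contextual [State.arr_setReg, h3, List.getElem?_singleton]
    · simp +contextual [List.getElem?_singleton]
    · simp +contextual [List.getElem?_singleton]
    · obtain rfl := (htake1 w).1 hw
      exact ⟨[], by simp [State.arr_setReg, h19],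
        ⟨mem_vertices_iff.2 (.inl rfl), List.prefix_rfl⟩, fun z hz => hz.2.length_le⟩
    · obtain rfl := (htake1 w).1 hw
      exact ⟨[], by simp [State.arr_setReg, h20],
        ⟨mem_vertices_iff.2 (.inl rfl), List.suffix_rfl⟩, fun z hz => hz.2.length_le⟩
    · simp [State.reg_setReg]
  refine hstart.frame.mono le_rfl ?_
  rintro s₁ ⟨⟨ho₁, h33₁⟩, hA₁⟩
  have ht₁ := ht.of_agrees hA₁ (by decide)
  have hs₁ := hs.of_agrees hA₁ (by decide) rfl
  refine (Runs.loop (W := W) (b := .lt 33 17) (s₀ := s₁) (p := outputStep)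
    (fun s => Outputting L ν q (s.reg 33) s ∧ s.reg 33 ≠ 0)
    (fun s => (n - s.reg 33) * (cost outputStep + 1)) ?_ ⟨ho₁, by lia⟩).mono ?_ ?_
  · rintro s' hA ⟨ho', h33'⟩ hb
    have hs' := hs₁.of_agrees hA (by decide) rfl
    simp only [Test.Holds, hs'.tail] at hb
    refine ⟨_, (outputStep_runs hW ((hA.1 2 rfl).trans ((hA₁.1 2 rfl).trans hc.reg2))
      (ht₁.of_agrees hA (by decide)) hs' ?_ rfl h33' hb ho').mono le_rfl ?_⟩
    · rwa [hA.2 12 rfl, hA₁.2 12 rfl]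
    · rintro s'' ⟨ho'', h33''⟩
      refine ⟨⟨by rwa [h33''], by lia⟩, ?_⟩
      rw [h33'', show n - s'.reg 33 = n - (s'.reg 33 + 1) + 1 by lia]
      lia
  · refine Nat.add_le_add_right (Nat.mul_le_mul_right _ ?_) 1
    have := ht.le
    lia
  · rintro s' ⟨⟨⟨E, hE, h0⟩, -⟩, hb, hA⟩
    simp only [Test.Holds, (hs₁.of_agrees hA (by decide) rfl).tail] at hb
    refine hE.storesHog ((hA.2 1 rfl).trans ((hA₁.2 1 rfl).trans hc.text)) h0 fun w hw => ?_
    rw [List.take_of_length_le (by lia)]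
    exact (hs.mem_iff w).2 hw

end Output

section Main

variable {σ : ℕ}

/-! ### The whole program -/

/-- The constants used by the program. -/
def initConstants (σ : ℕ) : Prog := block [.const 2 1, .const 3 (σ + 1), .const 4 σ, .copy 17 2]

/-- The program that builds the hierarchical overlap graph. -/
def buildHog (σ : ℕ) : Prog :=
  .seq (initConstants σ) (.seq insertStrings (.seq search (.seq markVertices output)))

/-- A bound on the number of steps of `buildHog` per letter of the input. -/
def stepBound (σ : ℕ) : ℕ :=
  cost (initConstants σ) + (cost letterStep + 1 + (cost stringStart + cost stringEnd + 2) + 1) +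
    (cost nodeStart + (σ * (cost childStep + 1) + 1) + 1 + 1) +
    (cost chainStep + 1 + (cost chainStart + cost chainEnd + 2) + 1) +
    (cost outputStart + (cost outputStep + 1 + 1))

/-- Only the empty string contributes no letter, and it occurs at most once. -/
theorem length_le_of_nodup {α : Type*} [DecidableEq α] {L : List (List α)} (hL : L.Nodup) :
    L.length ≤ L.flatten.length + 1 := by
  have h : ∀ M : List (List α), M.length ≤ M.flatten.length + M.count [] := fun M => by
    induction M with
    | nil => simp
    | cons x M ih =>
      cases x with
      | nil =>
        rw [List.count_cons_self, List.flatten_cons, List.nil_append, List.length_cons]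
        lia
      | cons a x =>
        rw [List.count_cons_of_ne (by simp), List.flatten_cons, List.length_append,
          List.length_cons, List.length_cons]
        lia
  exact (h L).trans (Nat.add_le_add_left (List.nodup_iff_count_le_one.1 hL []) _)

/-- The trie has at most one node per letter besides the root, each with a row of `σ + 1` cells; two
further rows give slack for the remaining values. -/
theorem wordBound {L : List (List (Fin σ))} (hL : L.Nodup) :
    WordBound L ((σ + 1) * (L.flatten.length + 3)) :=
  ⟨le_rfl, length_le_of_nodup hL⟩

theorem inputState_fits {L : List (List (Fin σ))} {W : ℕ} (hW : WordBound L W) :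
    (inputState L).Fits W := by
  have hWlt := hW.lt
  have hle := hW.length_le
  have hσ : σ < W := by
    have := hW.le
    nlinarith
  refine ⟨fun r => ?_, fun a i => ?_, fun a i hi => ?_⟩
  · simp only [inputState]
    split_ifs <;> lia
  · simp only [inputState]
    split_ifs
    · rcases lt_or_ge i L.length with hi | hi
      · have := pos_add_le hi
        rw [List.getD_eq_getElem _ _ (by rwa [List.length_map]), List.getElem_map]
        lia
      · rw [List.getD_eq_default _ _ (by rwa [List.length_map])]
        lia
    · rcases lt_or_ge i L.flatten.length with hi | hi
      · rw [List.getD_eq_getElem _ _ (by rwa [List.length_map]), List.getElem_map]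
        exact L.flatten[i].2.trans hσ
      · rw [List.getD_eq_default _ _ (by rwa [List.length_map])]
        lia
    · lia
  · simp only [inputState]
    split_ifs
    · rw [List.getD_eq_default _ _ (by rw [List.length_map]; lia)]
    · rw [List.getD_eq_default _ _ (by rw [List.length_map]; lia)]
    · rfl

theorem buildHog_runs {L : List (List (Fin σ))} (hL : L.Nodup) {W : ℕ} (hW : WordBound L W) :
    Runs W (buildHog σ) (inputState L) (stepBound σ * (L.flatten.length + 1)) (StoresHog L) := by
  have hWlt := hW.lt
  have hσ : σ + 1 < W := by
    have := hW.le
    nlinarith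
  have harr : ∀ a, 2 ≤ a → (inputState L).arr a = fun _ => 0 := fun a ha => by
    funext i
    simp [inputState, show a ≠ 0 by lia, show a ≠ 1 by lia]
  have hreg : ∀ r, r ≠ 0 → (inputState L).reg r = 0 := fun r hr => by simp [inputState, hr]
  have hinit : Runs W (initConstants σ) (inputState L) (cost (initConstants σ))
      (fun s => Consts L s ∧ s.reg 17 = 1) := by
    refine Runs.of_wp _ ?_
    simp only [initConstants, block, wp, State.reg_setReg]
    refine ⟨by lia, by lia, by lia, ⟨?_, ?_, ?_, ?_, ?_, rfl, rfl⟩, ?_⟩ <;>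
      simp [State.reg_setReg, inputState]
  have hrun : Runs W (buildHog σ) (inputState L)
      (cost (initConstants σ) + ((L.flatten.length * (cost letterStep + 1) +
        L.length * (cost stringStart + cost stringEnd + 2) + 1) +
        (((L.flatten.length + 1) * (cost nodeStart + (σ * (cost childStep + 1) + 1) + 1) + 1) +
          ((L.flatten.length * (cost chainStep + 1) +
            L.length * (cost chainStart + cost chainEnd + 2) + 1) +
            (cost outputStart + ((L.flatten.length + 1) * (cost outputStep + 1) + 1))))))
      (StoresHog L) := by
    refine Runs.seq (hinit.frame.mono le_rfl ?_)
    rintro s₁ ⟨⟨hc₁, h17₁⟩, hA₁⟩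
    refine Runs.seq ((insertStrings_runs hW hc₁ ((hA₁.1 5 rfl).trans (hreg 5 (by lia)))
      ((hA₁.1 6 rfl).trans (hreg 6 (by lia))) ((hA₁.1 7 rfl).trans (hreg 7 (by lia)))
      fun a h6 _ => (hA₁.2 a rfl).trans (harr a (by lia))).frame.mono le_rfl ?_)
    rintro s₂ ⟨⟨ν, n, hn, ht, he⟩, hA₂⟩
    have hc₂ := hc₁.of_agrees hA₂ (by decide) (by decide)
    have ht₂ : TrieDone L ν n s₂ := ⟨ht, hn, he⟩
    have harr₂ : ∀ a, 12 ≤ a → a ≤ 20 → s₂.arr a = fun _ => 0 := fun a h12 h20 =>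
      (hA₂.2 a (by interval_cases a <;> rfl)).trans ((hA₁.2 a rfl).trans (harr a (by lia)))
    refine Runs.seq ((search_runs hW hc₂ ht₂
      ((hA₂.1 16 rfl).trans ((hA₁.1 16 rfl).trans (hreg 16 (by lia)))) ((hA₂.1 17 rfl).trans h17₁)
      fun a h13 h17 => harr₂ a (by lia) (by lia)).frame.mono le_rfl ?_)
    rintro s₃ ⟨⟨q, h, hh, hs⟩, hA₃⟩
    have hc₃ := hc₂.of_agrees hA₃ (by decide) (by decide)
    have ht₃ := ht₂.of_agrees hA₃ (by decide)
    have hs₃ := hs.done hh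
    refine Runs.seq ((markVertices_runs hL hW hc₃ ht₃ hs₃
      ((hA₃.1 28 rfl).trans ((hA₂.1 28 rfl).trans ((hA₁.1 28 rfl).trans (hreg 28 (by lia)))))
      ((hA₃.2 12 rfl).trans (harr₂ 12 (by lia) (by lia)))
      ((hA₃.2 18 rfl).trans (harr₂ 18 (by lia) (by lia)))).frame.mono le_rfl ?_)
    rintro s₄ ⟨hm, hA₄⟩
    refine output_runs hW (hc₃.of_agrees hA₄ (by decide) (by decide))
      (ht₃.of_agrees hA₄ (by decide)) (hs₃.of_agrees hA₄ (by decide) rfl)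
      (fun w hw h0 => (hm w hw h0).trans (marked_iff h0)) ?_ ?_ ?_
    · exact (hA₄.2 3 rfl).trans ((hA₃.2 3 rfl).trans ((hA₂.2 3 rfl).trans
        ((hA₁.2 3 rfl).trans (harr 3 (by lia)))))
    · exact (hA₄.2 19 rfl).trans ((hA₃.2 19 rfl).trans (harr₂ 19 (by lia) (by lia)))
    · exact (hA₄.2 20 rfl).trans ((hA₃.2 20 rfl).trans (harr₂ 20 (by lia) (by lia)))
  refine hrun.mono ?_ fun _ h => h
  have hk := hW.length_le
  generalize L.flatten.length = N at hk ⊢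
  generalize L.length = k at hk ⊢
  simp only [stepBound]
  generalize cost (initConstants σ) = c₀
  generalize cost letterStep + 1 = c₁
  generalize cost stringStart + cost stringEnd + 2 = c₂
  generalize cost nodeStart + (σ * (cost childStep + 1) + 1) + 1 = c₃
  generalize cost chainStep + 1 = c₄
  generalize cost chainStart + cost chainEnd + 2 = c₅
  generalize cost outputStart = c₆
  generalize cost outputStep + 1 = c₇
  have h₂ := Nat.mul_le_mul_right c₂ hk
  have h₅ := Nat.mul_le_mul_right c₅ hk
  nlinarith [Nat.zero_le (N * c₀), Nat.zero_le (N * c₆)]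

end Main
end HOG

/-- For every constant alphabet there are one program and one constant `C` such that, for all sets
`P` of strings (listed in any order), the program builds the hierarchical overlap graph of `P` in at
most `C * (‖P‖ + 1)` steps, with at most `C * (‖P‖ + 1)` memory words, which only ever hold values
below some `W ≤ C * (‖P‖ + 1)`. -/
theorem theorem2 (σ : ℕ) :
    ∃ (p : HOG.Prog) (C : ℕ), ∀ L : List (List (Fin σ)), L.Nodup →
      ∃ (W t : ℕ) (s : HOG.State),
        (HOG.inputState L).Fits W ∧
        HOG.Exec W p (HOG.inputState L) t s ∧
        HOG.StoresHog L s ∧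
        t ≤ C * (HOG.totalLength L + 1) ∧
        p.space W ≤ C * (HOG.totalLength L + 1) ∧
        W ≤ C * (HOG.totalLength L + 1) := by
  refine ⟨HOG.buildHog σ, HOG.stepBound σ + (HOG.buildHog σ).regs.card +
    ((HOG.buildHog σ).arrays.card + 1) * (3 * (σ + 1)), fun L hL => ?_⟩
  have hW := HOG.wordBound hL
  obtain ⟨t, s, he, ht, hs⟩ := HOG.buildHog_runs hL hW
  refine ⟨_, t, s, HOG.inputState_fits hW, he, hs, ?_⟩
  have hlen : HOG.totalLength L = L.flatten.length := List.length_flatten.symm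
  -- From `N + 3 ≤ 3 * (N + 1)`; the word bound is linear with the factor `3 * (σ + 1)` used in `C`.
  have hbound : (σ + 1) * (L.flatten.length + 3) ≤ 3 * (σ + 1) * (L.flatten.length + 1) := by
    nlinarith
  rw [HOG.Prog.space, hlen]
  generalize (HOG.buildHog σ).regs.card = r
  generalize (HOG.buildHog σ).arrays.card = a
  generalize HOG.stepBound σ = c at ht ⊢
  generalize (σ + 1) * (L.flatten.length + 3) = W at hbound ⊢
  generalize 3 * (σ + 1) = d at hbound ⊢
  generalize L.flatten.length = N at ht hbound ⊢
  have h1 := Nat.mul_le_mul_left a hbound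
  have h2 : (c + r + (a + 1) * d) * (N + 1) =
      c * (N + 1) + r * N + r + a * (d * (N + 1)) + d * (N + 1) := by ring
  rw [h2]
  exact ⟨by lia, by lia, by lia⟩
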